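/- Let $k$ be a field, let $d\ge 2$, and let $\mathcal H$ be a $d$-uniform hypergraph on the vertex set $[n]$ (every edge is a $d$-element subset of $[n]$). Put $R=k[x_1,\dots,x_n]$, and let $\Delta=\Delta(\mathcal H)$ be the simplicial complex whose faces are the sets $F\subseteq[n]$ all of whose $d$-element subsets are edges of $\mathcal H$. Write $\Delta_V=\{F\in\Delta : F\subseteq V\}$ for $V\subseteq[n]$, and let $I_\Delta=(\prod_{i\in F}x_i : F\notin\Delta)$ be the Stanley--Reisner ideal. Let $$\mathrm{con}(\mathcal H)=\min\{|V| : V\subseteq[n],\ \tilde H_{d-2}(\Delta_{[n]\setminus V};k)\ne 0\},\qquad \min\emptyset=\infty.$$ Let $\beta_{i,j}=\dim_k\mathrm{Tor}_i^R(R/I_\Delta,k)_j$ be the graded Betti numbers of $R/I_\Delta$, computed as $\dim_k H_i(F\otimes_R k)_j$ from an arbitrary resolution $F$ of $R/I_\Delta$ by finitely generated graded free $R$-modules. Let $g=\mathrm{depth}_R(R/I_\Delta)$ be the maximal length of an $R/I_\Delta$-regular sequence in $(x_1,\dots,x_n)$, and let $p=\mathrm{pd}_R(R/I_\Delta)=\max\{i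 : \mathrm{Tor}_i^R(R/I_\Delta,k)\neq 0\}$. If some $d$-element subset of $[n]$ is not an edge of $\mathcal H$, then $\mathrm{con}(\mathcal H)$ is finite, the length $l=\max\{i : \beta_{i,i+d-1}\ne0\}$ of the linear strand exists, and so does the least integer $r$ with $\beta_{n-g-r,\;n-g-r+d-1}\neq 0$. This $r$ is also the least integer for which there is a $V\subseteq[n]$ with $|V|=n-(g-d+r+1)$ and $\tilde H_{d-2}(\Delta_V;k)\ne0$. Moreover $r\ge 0$, $r=p-l$, and $$\mathrm{con}(\mathcal H)=g-d+r+1 .$$ In particular, if the linear strand has maximal length, that is, if $l=p$, then $\mathrm{depth}_R(R/I_\Delta)=\mathrm{con}(\mathcal H)+d-1$. If every $d$-element subset of $[n]$ is an edge (in particular if $n<d$), then $\mathrm{con}(\mathcal H)=\infty$ and $\beta_{i,i+d-1}=0$ for all $i$, so that no such $r$ exists. -/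

import Mathlib

open MvPolynomial

noncomputable section

/-! ### Simplicial complexes and their reduced homology

A simplicial complex on the vertex set `Fin n` is a family of finite subsets that is closed under
passing to subsets, that is, a `LowerSet (Finset (Fin n))`. The empty face belongs to every
complex that has a face at all, and the void complex `⊥` is allowed. -/

namespace SComplex

variable {n : ℕ}

/-- The induced subcomplex `Δ_V = {F ∈ Δ | F ⊆ V}`. -/
def induced (Δ : LowerSet (Finset (Fin n))) (V : Finset (Fin n)) : LowerSet (Finset (Fin n)) :=
  Δ ⊓ LowerSet.Iic V

/-- The simplicial boundary map on formal linear combinations of subsets of `Fin n`, which are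
written as functions `f` (with `f F` the coefficient of `F`). It is given by
`∂ F = ∑_{v ∈ F} (-1) ^ #{u ∈ F | u < v} (F \ {v})`, so that the coefficient of `G` in `∂ f` comes
from the sets `F = G ∪ {v}` with `v ∉ G`. On points it is the augmentation. -/
def boundary (k : Type*) [Field k] : (Finset (Fin n) → k) →ₗ[k] (Finset (Fin n) → k) where
  toFun f G := ∑ v ∈ Finset.univ \ G, (-1 : k) ^ (G.filter (· < v)).card * f (insert v G)
  map_add' f g := by
    funext G
    simp only [Pi.add_apply, mul_add, Finset.sum_add_distrib]
  map_smul' c f := by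
    funext G
    simp only [Pi.smul_apply, smul_eq_mul, RingHom.id_apply, Finset.mul_sum, mul_left_comm]

/-- The chains of dimension `q ≥ -1` of the augmented chain complex of `Δ`: the combinations of
the faces with `q + 1` vertices. -/
def chains (k : Type*) [Field k] (Δ : LowerSet (Finset (Fin n))) (q : ℤ) :
    Submodule k (Finset (Fin n) → k) where
  carrier := {f | ∀ F, f F ≠ 0 → F ∈ Δ ∧ (F.card : ℤ) = q + 1}
  zero_mem' := fun F hF => absurd rfl hF
  add_mem' := by
    intro f g hf hg F hF
    by_cases h : f F = 0
    · exact hg F fun h' => hF (by simp [h, h'])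
    · exact hf F h
  smul_mem' := fun c f hf F hF => hf F fun h => hF (by simp [h])

/-- The cycles of dimension `q`. -/
def cycles (k : Type*) [Field k] (Δ : LowerSet (Finset (Fin n))) (q : ℤ) :
    Submodule k (Finset (Fin n) → k) :=
  chains k Δ q ⊓ LinearMap.ker (boundary k)

/-- The boundaries of dimension `q`. -/
def boundaries (k : Type*) [Field k] (Δ : LowerSet (Finset (Fin n))) (q : ℤ) :
    Submodule k (Finset (Fin n) → k) :=
  (chains k Δ (q + 1)).map (boundary k)

/-- The reduced homology `H̃_q(Δ; k)`. -/
abbrev ReducedHomology (k : Type*) [Field k] (Δ : LowerSet (Finset (Fin n))) (q : ℤ) : Type _ :=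
  cycles k Δ q ⧸ (boundaries k Δ q).submoduleOf (cycles k Δ q)

/-- The Stanley--Reisner ideal `I_Δ`, generated by the monomials `x^F` for the nonfaces `F`. -/
def stanleyReisnerIdeal (k : Type*) [Field k] (Δ : LowerSet (Finset (Fin n))) :
    Ideal (MvPolynomial (Fin n) k) :=
  Ideal.span {p | ∃ F : Finset (Fin n), F ∉ Δ ∧ p = ∏ i ∈ F, X i}

end SComplex

/-! ### Hypergraphs -/

namespace Hypergraph

variable {n : ℕ}

/-- `H` is a `d`-uniform hypergraph with vertex set all of `Fin n`. -/
def IsUniformOn (H : Hypergraph (Fin n)) (d : ℕ) : Prop :=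
  H.vertexSet = Set.univ ∧ ∀ E ∈ H.edgeSet, E.ncard = d

/-- All `d`-element sets of vertices are edges. For `n < d` this holds for every `H`. -/
def ContainsAll (H : Hypergraph (Fin n)) (d : ℕ) : Prop :=
  ∀ G : Finset (Fin n), G.card = d → (G : Set (Fin n)) ∈ H.edgeSet

/-- The clique complex of a `d`-uniform hypergraph: the faces are the sets `F` of vertices all of
whose `d`-element subsets are edges. -/
def cliqueComplex (H : Hypergraph (Fin n)) (d : ℕ) : LowerSet (Finset (Fin n)) where
  carrier := {F | ∀ G ⊆ F, G.card = d → (G : Set (Fin n)) ∈ H.edgeSet}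
  lower' := fun _ _ hba ha G hG => ha G (hG.trans hba)

/-- The connectivity over `k` of a `d`-uniform hypergraph: the least cardinality of a set `V` of
vertices such that `H̃_{d-2}(Δ(H)_{[n] \ V}; k) ≠ 0`, and `⊤` if there is no such set. -/
def connectivity (k : Type*) [Field k] (H : Hypergraph (Fin n)) (d : ℕ) : ℕ∞ :=
  ⨅ V ∈ {V : Finset (Fin n) | Module.finrank k (SComplex.ReducedHomology k
    (SComplex.induced (H.cliqueComplex d) (Finset.univ \ V)) ((d : ℤ) - 2)) ≠ 0}, (V.card : ℕ∞)

end Hypergraph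

/-! ### Depth -/

/-- The depth of a module `M` over `R = k[x_1, …, x_n]` with respect to the homogeneous maximal
ideal `(x_1, …, x_n)`: the supremum of the lengths of the `M`-regular sequences in that ideal. -/
def polyDepth {k : Type*} [Field k] {n : ℕ} (M : Type*) [AddCommGroup M]
    [Module (MvPolynomial (Fin n) k) M] : ℕ∞ :=
  ⨆ rs ∈ {rs : List (MvPolynomial (Fin n) k) | RingTheory.Sequence.IsRegular M rs ∧
    ∀ r ∈ rs, r ∈ Ideal.span (Set.range (X : Fin n → MvPolynomial (Fin n) k))},
    (rs.length : ℕ∞)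

/-! ### Graded free resolutions and graded Betti numbers -/

/-- A resolution `⋯ → F_2 → F_1 → F_0 → R/I → 0` by finitely generated graded free modules
over `R = k[x_1, …, x_n]`, with maps homogeneous of degree `0`; minimality is not required.
Here `F_i` is free on generators of degrees `deg i a`, `a : Fin (rank i)`. The differential
`F_{i+1} → F_i` is a matrix `d i` whose entry in position `(a, b)` is homogeneous of degree
`deg (i+1) b - deg i a` (zero if that is negative), and the generator `a` of `F_0` is sent to the
class of the polynomial `aug a`, homogeneous of degree `deg 0 a`. -/
structure GradedFreeResolution {k : Type*} [Field k] {n : ℕ}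
    (I : Ideal (MvPolynomial (Fin n) k)) where
  rank : ℕ → ℕ
  deg : (i : ℕ) → Fin (rank i) → ℕ
  d : (i : ℕ) → Matrix (Fin (rank i)) (Fin (rank (i + 1))) (MvPolynomial (Fin n) k)
  aug : Fin (rank 0) → MvPolynomial (Fin n) k
  d_homogeneous : ∀ i a b, ∀ e ∈ (d i a b).support, e.degree + deg i a = deg (i + 1) b
  aug_homogeneous : ∀ a, (aug a).IsHomogeneous (deg 0 a)
  aug_surjective : ∀ p : MvPolynomial (Fin n) k,
    ∃ v : Fin (rank 0) → MvPolynomial (Fin n) k, p - ∑ a, v a * aug a ∈ I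
  exact_zero : ∀ v : Fin (rank 0) → MvPolynomial (Fin n) k,
    ∑ a, v a * aug a ∈ I ↔ v ∈ LinearMap.range (d 0).mulVecLin
  exact_succ : ∀ i, Function.Exact (d (i + 1)).mulVecLin (d i).mulVecLin

namespace GradedFreeResolution

variable {k : Type*} [Field k] {n : ℕ} {I : Ideal (MvPolynomial (Fin n) k)}

/-- The differential `(F_{i+1} ⊗_R k)_j → (F_i ⊗_R k)_j`. As `k = R/(x_1, …, x_n)`, the space
`(F_i ⊗_R k)_j` has the generators of degree `j` of `F_i` as a basis, and the matrix consists of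
the constant coefficients. -/
def tensorD (F : GradedFreeResolution I) (i j : ℕ) :
    ({b : Fin (F.rank (i + 1)) // F.deg (i + 1) b = j} → k) →ₗ[k]
      ({a : Fin (F.rank i) // F.deg i a = j} → k) :=
  (((F.d i).map constantCoeff).submatrix Subtype.val Subtype.val).mulVecLin

/-- The cycles of `F ⊗_R k` in homological degree `i` and internal degree `j`. -/
def tensorCycles (F : GradedFreeResolution I) :
    (i j : ℕ) → Submodule k ({a : Fin (F.rank i) // F.deg i a = j} → k)
  | 0, _ => ⊤
  | i + 1, j => LinearMap.ker (F.tensorD i j)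

/-- `Tor_i^R(R/I, k)_j`, the degree `j` part of the `i`-th homology of `F ⊗_R k`. -/
abbrev Tor (F : GradedFreeResolution I) (i j : ℕ) : Type _ :=
  F.tensorCycles i j ⧸ (LinearMap.range (F.tensorD i j)).submoduleOf (F.tensorCycles i j)

/-- The graded Betti number `β_{i,j}(R/I) = dim_k Tor_i^R(R/I, k)_j`. -/
def betti (F : GradedFreeResolution I) (i j : ℕ) : ℕ := Module.finrank k (F.Tor i j)

end GradedFreeResolution

/-! ### Stanley--Reisner rings have graded free resolutions -/

namespace GradedFreeResolution

variable {k : Type*} [Field k] {n : ℕ}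

/-- The degree `t` component of an element of a graded free module. -/
def comp {l : ℕ} (deg : Fin l → ℕ) (t : ℕ) (v : Fin l → MvPolynomial (Fin n) k) :
    Fin l → MvPolynomial (Fin n) k :=
  fun a => if deg a ≤ t then homogeneousComponent (t - deg a) (v a) else 0

theorem coeff_comp {l : ℕ} (deg : Fin l → ℕ) (t : ℕ) (v : Fin l → MvPolynomial (Fin n) k)
    (a : Fin l) (e : Fin n →₀ ℕ) :
    coeff e (comp deg t v a) = if e.degree + deg a = t then coeff e (v a) else 0 := by
  unfold comp
  split_ifs with h1 h2 h2
  · rw [coeff_homogeneousComponent, if_pos (by omega)]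
  · rw [coeff_homogeneousComponent, if_neg (by omega)]
  · omega
  · simp

theorem exists_sum_comp {l : ℕ} (deg : Fin l → ℕ) (v : Fin l → MvPolynomial (Fin n) k) :
    ∃ T : ℕ, v = ∑ t ∈ Finset.range T, comp deg t v := by
  refine ⟨(Finset.univ.sup fun a => (v a).totalDegree + deg a) + 1, ?_⟩
  funext a
  ext e
  rw [Finset.sum_apply, coeff_sum]
  simp only [coeff_comp, Finset.sum_ite_eq, Finset.mem_range]
  split_ifs with h
  · rfl
  · by_contra hne
    have h1 : e.degree ≤ (v a).totalDegree := le_totalDegree (mem_support_iff.mpr hne)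
    have h2 : (v a).totalDegree + deg a ≤ _ :=
      Finset.le_sup (f := fun a => (v a).totalDegree + deg a) (Finset.mem_univ a)
    omega

/-- A matrix whose `(a, b)` entry is homogeneous of degree `degm b - degl a`. -/
def Homog {l m : ℕ} (degl : Fin l → ℕ) (degm : Fin m → ℕ)
    (D : Matrix (Fin l) (Fin m) (MvPolynomial (Fin n) k)) : Prop :=
  ∀ a b, ∀ e ∈ (D a b).support, e.degree + degl a = degm b

theorem mulVec_comp {l m : ℕ} {degl : Fin l → ℕ} {degm : Fin m → ℕ}
    {D : Matrix (Fin l) (Fin m) (MvPolynomial (Fin n) k)} (hD : Homog degl degm D)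
    (t : ℕ) (v : Fin m → MvPolynomial (Fin n) k) :
    D.mulVecLin (comp degm t v) = comp degl t (D.mulVecLin v) := by
  funext a
  ext e
  rw [coeff_comp]
  change coeff e (∑ b, D a b * comp degm t v b) = if _ then coeff e (∑ b, D a b * v b) else 0
  have key : ∀ b, coeff e (D a b * comp degm t v b) =
      if e.degree + degl a = t then coeff e (D a b * v b) else 0 := by
    intro b
    rw [coeff_mul, coeff_mul]
    split_ifs with h
    · refine Finset.sum_congr rfl fun x hx => ?_
      by_cases h0 : coeff x.1 (D a b) = 0
      · simp [h0]
      · have h1 := hD a b x.1 (mem_support_iff.mpr h0)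
        have h2 : x.1.degree + x.2.degree = e.degree := by
          rw [← map_add, Finset.HasAntidiagonal.mem_antidiagonal.mp hx]
        rw [coeff_comp, if_pos (by omega)]
    · refine Finset.sum_eq_zero fun x hx => ?_
      by_cases h0 : coeff x.1 (D a b) = 0
      · simp [h0]
      · have h1 := hD a b x.1 (mem_support_iff.mpr h0)
        have h2 : x.1.degree + x.2.degree = e.degree := by
          rw [← map_add, Finset.HasAntidiagonal.mem_antidiagonal.mp hx]
        rw [coeff_comp, if_neg (by omega), mul_zero]
  rw [coeff_sum, coeff_sum, Finset.sum_congr rfl fun b _ => key b]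
  split_ifs <;> simp

/-- A submodule of a graded free module that contains the components of its elements. -/
def IsGraded {l : ℕ} (deg : Fin l → ℕ)
    (N : Submodule (MvPolynomial (Fin n) k) (Fin l → MvPolynomial (Fin n) k)) : Prop :=
  ∀ v ∈ N, ∀ t, comp deg t v ∈ N

theorem comp_zero {l : ℕ} (deg : Fin l → ℕ) (t : ℕ) :
    comp deg t (0 : Fin l → MvPolynomial (Fin n) k) = 0 := by
  funext a
  ext e
  rw [coeff_comp]
  simp

theorem isGraded_ker {l m : ℕ} {degl : Fin l → ℕ} {degm : Fin m → ℕ}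
    {D : Matrix (Fin l) (Fin m) (MvPolynomial (Fin n) k)} (hD : Homog degl degm D) :
    IsGraded degm (LinearMap.ker D.mulVecLin) := by
  intro v hv t
  rw [LinearMap.mem_ker] at hv ⊢
  rw [mulVec_comp hD, hv, comp_zero]

theorem exists_matrix {l : ℕ} (degl : Fin l → ℕ)
    (N : Submodule (MvPolynomial (Fin n) k) (Fin l → MvPolynomial (Fin n) k))
    (hN : IsGraded degl N) :
    ∃ (m : ℕ) (degm : Fin m → ℕ) (D : Matrix (Fin l) (Fin m) (MvPolynomial (Fin n) k)),
      Homog degl degm D ∧ LinearMap.range D.mulVecLin = N := by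
  classical
  let S : Set (Fin l → MvPolynomial (Fin n) k) :=
    {w | w ∈ N ∧ ∃ t : ℕ, ∀ a, ∀ e ∈ (w a).support, e.degree + degl a = t}
  have hS : Submodule.span (MvPolynomial (Fin n) k) S = N := by
    apply le_antisymm
    · exact Submodule.span_le.mpr fun w hw => hw.1
    · intro v hv
      obtain ⟨T, hT⟩ := exists_sum_comp degl v
      rw [hT]
      refine Submodule.sum_mem _ fun t _ => Submodule.subset_span ⟨hN v hv t, t, ?_⟩
      intro a e he
      rw [mem_support_iff, coeff_comp] at he
      by_contra h
      exact he (if_neg h)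
  have hfg : (Submodule.span (MvPolynomial (Fin n) k) S).FG := IsNoetherian.noetherian _
  obtain ⟨s, hsS, hs⟩ := (Submodule.fg_span_iff_fg_span_finset_subset S).mp hfg
  have hdeg : ∀ b : Fin s.card, ∃ t : ℕ, ∀ a, ∀ e ∈ ((s.equivFin.symm b).1 a).support,
      e.degree + degl a = t := fun b => (hsS (s.equivFin.symm b).2).2
  choose degm hdegm using hdeg
  refine ⟨s.card, degm, Matrix.of fun a b => (s.equivFin.symm b).1 a,
    fun a b => hdegm b a, ?_⟩
  rw [Matrix.range_mulVecLin, ← hS, hs]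
  congr 1
  ext w
  constructor
  · rintro ⟨b, rfl⟩
    exact (s.equivFin.symm b).2
  · intro hw
    exact ⟨s.equivFin ⟨w, hw⟩, by funext a; simp [Matrix.col]⟩

/-- A stage in the construction of a resolution: a graded submodule of a graded free module. -/
structure Stage (k : Type*) [Field k] (n : ℕ) where
  l : ℕ
  deg : Fin l → ℕ
  N : Submodule (MvPolynomial (Fin n) k) (Fin l → MvPolynomial (Fin n) k)
  graded : IsGraded deg N

namespace Stage

/-- The number of homogeneous generators chosen for the submodule. -/
def m (s : Stage k n) : ℕ := (exists_matrix s.deg s.N s.graded).choose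

/-- The degrees of these generators. -/
def degm (s : Stage k n) : Fin s.m → ℕ := (exists_matrix s.deg s.N s.graded).choose_spec.choose

/-- The matrix with these generators as columns. -/
def D (s : Stage k n) : Matrix (Fin s.l) (Fin s.m) (MvPolynomial (Fin n) k) :=
  (exists_matrix s.deg s.N s.graded).choose_spec.choose_spec.choose

theorem D_homog (s : Stage k n) : Homog s.deg s.degm s.D :=
  (exists_matrix s.deg s.N s.graded).choose_spec.choose_spec.choose_spec.1

theorem D_range (s : Stage k n) : LinearMap.range s.D.mulVecLin = s.N :=
  (exists_matrix s.deg s.N s.graded).choose_spec.choose_spec.choose_spec.2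

/-- The module of relations between the chosen generators. -/
def next (s : Stage k n) : Stage k n :=
  ⟨s.m, s.degm, LinearMap.ker s.D.mulVecLin, isGraded_ker s.D_homog⟩

/-- The `i`-th syzygy module. -/
def iter (s : Stage k n) : ℕ → Stage k n
  | 0 => s
  | i + 1 => (iter s i).next

end Stage

theorem nonempty_of_components (I : Ideal (MvPolynomial (Fin n) k))
    (hI : ∀ p ∈ I, ∀ t, homogeneousComponent t p ∈ I) : Nonempty (GradedFreeResolution I) := by
  let s : Stage k n :=
    { l := 1
      deg := fun _ => 0
      N := Submodule.comap (LinearMap.proj (0 : Fin 1)) I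
      graded := fun v hv t => hI _ hv t }
  refine ⟨{
    rank := fun i => (s.iter i).l
    deg := fun i => (s.iter i).deg
    d := fun i => (s.iter i).D
    aug := fun _ => 1
    d_homogeneous := fun i => (s.iter i).D_homog
    aug_homogeneous := fun _ => isHomogeneous_one _ _
    aug_surjective := fun p => ⟨fun _ => p, ?_⟩
    exact_zero := fun v => ?_
    exact_succ := fun i => ?_ }⟩
  · change p - ∑ _a : Fin 1, p * 1 ∈ I
    simp
  · have h : v ∈ LinearMap.range (s.iter 0).D.mulVecLin ↔ v ∈ (s.iter 0).N := by
      rw [(s.iter 0).D_range]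
    refine Iff.trans ?_ h.symm
    change ∑ a : Fin 1, v a * 1 ∈ I ↔ v (0 : Fin 1) ∈ I
    rw [Fin.sum_univ_one, mul_one]
  · rw [LinearMap.exact_iff]
    exact (s.iter (i + 1)).D_range.symm

theorem nonempty_stanleyReisner (Δ : LowerSet (Finset (Fin n))) :
    Nonempty (GradedFreeResolution (SComplex.stanleyReisnerIdeal k Δ)) := by
  apply nonempty_of_components
  let _ : GradedAlgebra (homogeneousSubmodule (Fin n) k) := MvPolynomial.gradedAlgebra
  have h : (SComplex.stanleyReisnerIdeal k Δ).IsHomogeneous (homogeneousSubmodule (Fin n) k) := by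
    apply Ideal.homogeneous_span
    rintro p ⟨F, -, rfl⟩
    exact ⟨_, IsHomogeneous.prod F _ (fun _ => 1) fun i _ => isHomogeneous_X k i⟩
  intro p hp t
  exact homogeneousComponent_mem_of_mem h hp t

end GradedFreeResolution

end

/-!
Write `R = k[x_1, …, x_n]`, let `Δ` be the clique complex, and let `M = R/I_Δ`. All invariants in
the theorem are read off from the Koszul homology `H_i(x; M)` of the variables.

*Betti numbers.* For a graded free resolution `F` of `M` and a degree `j`, the degree `j` part of
`F ⊗ K(x; R)` is a double complex whose rows and columns are exact in positive degrees. The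
cokernels of its rows form the Koszul complex of `M`, those of its columns form `F ⊗ k`, so a
diagram chase
(`ExactDoubleComplex.colVanish_zero_iff_rowVanish_zero`) shows that `β_{i,j} = 0` if and only if
`H_i(x; M)_j = 0` (`GradedFreeResolution.betti_eq_zero_iff_acyclicIn`). The columns are exact
because `K(x; R)` is acyclic in positive homological degree, multidegree by multidegree.

*Depth.* Dividing out a nonzerodivisor in `(x_1, …, x_n)` raises the top nonvanishing degree of
Koszul homology by one, and there is such a nonzerodivisor unless that degree is `n`. So the depth
is `n` minus this degree (`polyDepth_eq`), and since this degree is also the projective dimension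
`p`, one gets the Auslander--Buchsbaum formula `g = n - p`
(`GradedFreeResolution.exists_pd_and_polyDepth`).

*Linear strand.* The Koszul complex of `M` splits into multigraded strands. Those whose multidegree
is not squarefree are contractible, and the strand of squarefree multidegree `V` is, up to signs,
the cochain complex of `Δ_V`. Dualizing, `β_{i,i+m} ≠ 0` if and only if there is a `V` with `i + m`
elements and `H̃_{m-1}(Δ_V; k) ≠ 0` (`GradedFreeResolution.betti_add_ne_zero_iff`).

For `m = d - 1` this says that the largest `V` with `H̃_{d-2}(Δ_V; k) ≠ 0` have `l + d - 1`
elements, where `l` is the length of the linear strand. Hence `con(H) = n - (l + d - 1)`, which is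
`g - d + r + 1` for `r = p - l`. Such sets exist as soon as some `d`-element set is not an edge,
since that set is then a minimal nonface; if there is none, `Δ` is a simplex and all its strands of
nonzero multidegree are contractible.
-/

noncomputable section

/-! ### Koszul complexes -/

namespace Koszul

variable {n : ℕ} {R : Type*} [CommRing R] {N : Type*} [AddCommGroup N] [Module R N]

/-- The incidence sign `(-1) ^ #{u ∈ G | u < v}`. -/
def sign (R : Type*) [CommRing R] (G : Finset (Fin n)) (v : Fin n) : R :=
  (-1) ^ (G.filter (· < v)).card

theorem sign_mul_self (G : Finset (Fin n)) (v : Fin n) : sign R G v * sign R G v = 1 := by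
  rw [sign, ← mul_pow]; simp

theorem sign_smul_sign_smul (G : Finset (Fin n)) (v : Fin n) (y : N) :
    sign R G v • sign R G v • y = y := by
  rw [smul_smul, sign_mul_self, one_smul]

theorem sign_insert_of_lt {G : Finset (Fin n)} {u v : Fin n} (hu : u ∉ G) (h : u < v) :
    sign R (insert u G) v = -sign R G v := by
  rw [sign, sign, Finset.filter_insert, if_pos h, Finset.card_insert_of_notMem (by simp [hu]),
    pow_succ, mul_neg_one]

theorem sign_insert_of_le {G : Finset (Fin n)} {u v : Fin n} (h : v ≤ u) :
    sign R (insert u G) v = sign R G v := by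
  rw [sign, sign, Finset.filter_insert, if_neg (not_lt.mpr h)]

/-- Adding two vertices to a set in either order gives opposite signs. -/
theorem sign_mul_sign_insert {G : Finset (Fin n)} {u v : Fin n} (hu : u ∉ G) (hv : v ∉ G)
    (h : u ≠ v) :
    sign R G v * sign R (insert v G) u = -(sign R G u * sign R (insert u G) v) := by
  rcases lt_or_gt_of_ne h with h | h
  · rw [sign_insert_of_lt hu h, sign_insert_of_le h.le]; ring
  · rw [sign_insert_of_lt hv h, sign_insert_of_le h.le]; ring

/-- The Koszul differential of a sequence `x` in `R` with coefficients in an `R`-module `N`. An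
element `∑ e_F ⊗ f_F` of `⋀ Rⁿ ⊗ N`, where `e_F` is the wedge of the basis vectors indexed by `F`,
is written as the function `F ↦ f_F`. -/
def d (x : Fin n → R) : (Finset (Fin n) → N) →ₗ[R] (Finset (Fin n) → N) where
  toFun f G := ∑ v ∈ Finset.univ \ G, sign R G v • x v • f (insert v G)
  map_add' f g := by
    funext G
    simp only [Pi.add_apply, smul_add, Finset.sum_add_distrib]
  map_smul' c f := by
    funext G
    simp only [Pi.smul_apply, RingHom.id_apply, Finset.smul_sum, smul_comm c]

theorem d_apply (x : Fin n → R) (f : Finset (Fin n) → N) (G : Finset (Fin n)) :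
    d x f G = ∑ v ∈ Finset.univ \ G, sign R G v • x v • f (insert v G) := rfl

theorem boundary_eq_d (k : Type*) [Field k] :
    SComplex.boundary k = d (n := n) (N := k) (fun _ => (1 : k)) := by
  ext f G
  simp [SComplex.boundary, d_apply, sign]

theorem d_map {N' : Type*} [AddCommGroup N'] [Module R N'] (x : Fin n → R) (L : N →ₗ[R] N')
    (f : Finset (Fin n) → N) : (d x fun F => L (f F)) = fun F => L (d x f F) := by
  funext G
  simp only [d_apply, map_sum, map_smul]

theorem d_d (x : Fin n → R) (f : Finset (Fin n) → N) : d x (d x f) = 0 := by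
  funext G
  simp only [d_apply, Pi.zero_apply, Finset.smul_sum]
  rw [Finset.sum_sigma']
  refine Finset.sum_involution (fun p _ => ⟨p.2, p.1⟩) ?_ ?_ ?_ ?_
  · rintro ⟨v, u⟩ h
    simp only [Finset.mem_sigma, Finset.mem_sdiff, Finset.mem_univ, true_and,
      Finset.mem_insert, not_or] at h
    obtain ⟨hv, huv, hu⟩ := h
    have hs := sign_mul_sign_insert (R := R) hu hv huv
    simp only [smul_smul]
    rw [Finset.insert_comm v u, ← add_smul]
    convert zero_smul R _
    linear_combination x v * x u * hs
  · rintro ⟨v, u⟩ h - heq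
    simp only [Finset.mem_sigma, Finset.mem_sdiff, Finset.mem_univ, true_and,
      Finset.mem_insert, not_or] at h
    simp only [Sigma.mk.injEq] at heq
    exact h.2.1 heq.1
  · rintro ⟨v, u⟩ h
    simp only [Finset.mem_sigma, Finset.mem_sdiff, Finset.mem_univ, true_and,
      Finset.mem_insert, not_or] at h ⊢
    exact ⟨h.2.2, fun h' => h.2.1 h'.symm, h.1⟩
  · rintro ⟨v, u⟩ h
    rfl

/-- Exterior multiplication by the `v`-th basis vector. -/
def cone (R : Type*) [CommRing R] [Module R N] (v : Fin n) :
    (Finset (Fin n) → N) →ₗ[R] (Finset (Fin n) → N) where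
  toFun f G := if v ∈ G then sign R G v • f (G.erase v) else 0
  map_add' f g := by
    funext G
    by_cases h : v ∈ G <;> simp [h]
  map_smul' c f := by
    funext G
    by_cases h : v ∈ G <;> simp [h, smul_comm c]

theorem cone_apply (v : Fin n) (f : Finset (Fin n) → N) (G : Finset (Fin n)) :
    cone R v f G = if v ∈ G then sign R G v • f (G.erase v) else 0 := rfl

/-- Multiplication by `x v` is null-homotopic on the Koszul complex. -/
theorem d_cone_add_cone_d (x : Fin n → R) (v : Fin n) (f : Finset (Fin n) → N) :
    d x (cone R v f) + cone R v (d x f) = x v • f := by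
  funext G
  rw [Pi.add_apply, Pi.smul_apply, cone_apply, d_apply]
  by_cases hv : v ∈ G
  · obtain ⟨G, hG, rfl⟩ : ∃ G', v ∉ G' ∧ G = insert v G' :=
      ⟨G.erase v, by simp, by simp [hv]⟩
    rw [if_pos (by simp), Finset.erase_insert hG, d_apply,
      show Finset.univ \ G = insert v (Finset.univ \ insert v G) by
        ext u; by_cases h : u = v <;> simp [h, hG],
      Finset.sum_insert (by simp), smul_add, sign_insert_of_le le_rfl, sign_smul_sign_smul,
      add_left_comm, add_eq_left, Finset.smul_sum, ← Finset.sum_add_distrib]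
    refine Finset.sum_eq_zero fun u hu => ?_
    simp only [Finset.mem_sdiff, Finset.mem_univ, true_and, Finset.mem_insert, not_or] at hu
    have hs := sign_mul_sign_insert (R := R) hu.2 hG hu.1
    rw [cone_apply, if_pos (by simp), Finset.insert_comm u v,
      Finset.erase_insert (by simp [hG, Ne.symm hu.1]), sign_insert_of_le le_rfl]
    simp only [smul_smul]
    rw [← add_smul]
    convert zero_smul R _
    have h1 := sign_mul_self (R := R) G u
    rcases lt_or_gt_of_ne hu.1 with h | h
    · rw [sign_insert_of_lt hu.2 h, sign_insert_of_le h.le]; ring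
    · rw [sign_insert_of_lt hG h, sign_insert_of_le h.le]; ring
  · rw [if_neg hv, add_zero, Finset.sum_eq_single v]
    · rw [cone_apply, if_pos (by simp), Finset.erase_insert hv, sign_insert_of_le le_rfl,
        smul_comm (x v), sign_smul_sign_smul]
    · intro u _ hu
      rw [cone_apply, if_neg (by simp [hv, Ne.symm hu]), smul_zero, smul_zero]
    · intro h
      simp [hv] at h

/-- The elements of homological degree `i` of the Koszul complex. -/
def IsChain (i : ℕ) (f : Finset (Fin n) → N) : Prop :=
  ∀ F, f F ≠ 0 → F.card = i

theorem IsChain.sub {i : ℕ} {f g : Finset (Fin n) → N} (hf : IsChain i f) (hg : IsChain i g) :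
    IsChain i (f - g) := by
  intro F hF
  by_cases h : f F = 0
  · exact hg F fun h' => hF (by simp [h, h'])
  · exact hf F h

theorem IsChain.smul {i : ℕ} {f : Finset (Fin n) → N} (hf : IsChain i f) (c : R) :
    IsChain i (c • f) :=
  fun F hF => hf F fun h => hF (by simp [h])

theorem IsChain.d {i : ℕ} {f : Finset (Fin n) → N} (hf : IsChain (i + 1) f) (x : Fin n → R) :
    IsChain i (d x f) := by
  intro G hG
  obtain ⟨v, hv, hne⟩ := Finset.exists_ne_zero_of_sum_ne_zero hG
  have h := hf (insert v G) fun h => hne (by simp [h])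
  rw [Finset.card_insert_of_notMem (by simpa using hv)] at h
  omega

theorem IsChain.d_eq_zero {f : Finset (Fin n) → N} (hf : IsChain 0 f) (x : Fin n → R) :
    Koszul.d x f = 0 := by
  funext G
  refine Finset.sum_eq_zero fun v hv => ?_
  by_contra hne
  have h := hf (insert v G) fun h => hne (by simp [h])
  simp at h

theorem IsChain.cone {i : ℕ} {f : Finset (Fin n) → N} (hf : IsChain i f) (v : Fin n) :
    IsChain (i + 1) (cone R v f) := by
  intro G hG
  rw [cone_apply] at hG
  split_ifs at hG with h
  · have h1 := hf (G.erase v) fun h' => hG (by simp [h'])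
    rw [← h1, Finset.card_erase_add_one h]
  · exact absurd rfl hG

theorem IsChain.map {N' : Type*} [AddCommGroup N'] [Module R N'] {i : ℕ}
    {f : Finset (Fin n) → N} (hf : IsChain i f) (L : N →ₗ[R] N') : IsChain i fun F => L (f F) :=
  fun F hF => hf F fun h => hF (by simp [h])

theorem IsChain.exists_lift {N' : Type*} [AddCommGroup N'] [Module R N'] {i : ℕ}
    {f : Finset (Fin n) → N'} (hf : IsChain i f) {L : N →ₗ[R] N'} (hL : Function.Surjective L) :
    ∃ g : Finset (Fin n) → N, IsChain i g ∧ f = fun F => L (g F) := by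
  choose g hg using fun F => hL (f F)
  refine ⟨fun F => if F.card = i then g F else 0, fun F hF => ?_, ?_⟩
  · by_contra h
    exact hF (if_neg h)
  · funext F
    by_cases h : F.card = i
    · simp only [if_pos h, hg]
    · simp only [if_neg h, map_zero]
      by_contra hne
      exact h (hf F hne)

/-- Any element of the ideal generated by `x` is null-homotopic on the Koszul complex. -/
theorem exists_homotopy {x : Fin n → R} {y : R} (hy : y ∈ Ideal.span (Set.range x)) :
    ∃ h : (Finset (Fin n) → N) →ₗ[R] (Finset (Fin n) → N),
      (∀ f, d x (h f) + h (d x f) = y • f) ∧ ∀ i f, IsChain i f → IsChain (i + 1) (h f) := by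
  obtain ⟨c, rfl⟩ := (Ideal.mem_span_range_iff_exists_fun).mp hy
  refine ⟨∑ v, c v • cone R v, fun f => ?_, fun i f hf F hF => ?_⟩
  · simp only [LinearMap.sum_apply, LinearMap.smul_apply, map_sum, map_smul, Finset.sum_smul,
      ← Finset.sum_add_distrib, ← smul_add, d_cone_add_cone_d, mul_smul]
  · simp only [LinearMap.sum_apply, LinearMap.smul_apply, Finset.sum_apply] at hF
    obtain ⟨v, -, hne⟩ := Finset.exists_ne_zero_of_sum_ne_zero hF
    exact (hf.cone v).smul (c v) F hne

end Koszul

/-! ### Depth sensitivity of the Koszul complex -/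

namespace Koszul

open RingTheory.Sequence Pointwise

variable {n : ℕ} {R : Type*} [CommRing R]

/-- The vanishing of the `i`-th Koszul homology of `x` with coefficients in `N`. -/
def Acyclic (x : Fin n → R) (N : Type*) [AddCommGroup N] [Module R N] (i : ℕ) : Prop :=
  ∀ f : Finset (Fin n) → N, IsChain i f → d x f = 0 → ∃ g, IsChain (i + 1) g ∧ d x g = f

section

variable {N : Type*} [AddCommGroup N] [Module R N]

theorem exists_smul_eq_of_mkQ_eq_zero {y : R} {i : ℕ} {f : Finset (Fin n) → N} (hf : IsChain i f)
    (h : (fun F => (y • (⊤ : Submodule R N)).mkQ (f F)) = 0) :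
    ∃ u, IsChain i u ∧ f = y • u := by
  classical
  have h1 : ∀ F, ∃ u, y • u = f F := by
    intro F
    have h2 : f F ∈ y • (⊤ : Submodule R N) :=
      (Submodule.Quotient.mk_eq_zero _).mp (congrFun h F)
    rw [Submodule.mem_smul_pointwise_iff_exists] at h2
    obtain ⟨u, -, hu⟩ := h2
    exact ⟨u, hu⟩
  choose u hu using h1
  refine ⟨fun F => if F.card = i then u F else 0, fun F hF => ?_, ?_⟩
  · by_contra h
    exact hF (if_neg h)
  · funext F
    by_cases h : F.card = i
    · simp only [Pi.smul_apply, if_pos h, hu]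
    · simp only [Pi.smul_apply, if_neg h, smul_zero]
      by_contra hne
      exact h (hf F hne)

theorem smul_injective {y : R} (hy : IsSMulRegular N y) {f g : Finset (Fin n) → N}
    (h : y • f = y • g) : f = g :=
  funext fun F => hy (congrFun h F)

variable {x : Fin n → R} {y : R}

/-- This lemma and the next one are consequences of the exact sequence
`0 → H_{i+1}(N) → H_{i+1}(N/yN) → H_i(N) → 0` for an `N`-regular `y` in the ideal of `x`. -/
theorem Acyclic.quotSMulTop (hy : IsSMulRegular N y) {i : ℕ}
    (h0 : Acyclic x N i) (h1 : Acyclic x N (i + 1)) : Acyclic x (QuotSMulTop y N) (i + 1) := by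
  intro f hf hdf
  obtain ⟨f, hf', rfl⟩ := hf.exists_lift (Submodule.mkQ_surjective _)
  rw [d_map] at hdf
  obtain ⟨u, hu, hfu⟩ := exists_smul_eq_of_mkQ_eq_zero (hf'.d x) hdf
  have hdu : d x u = 0 := by
    refine smul_injective hy ?_
    rw [← map_smul, ← hfu, d_d, smul_zero]
  obtain ⟨w, hw, rfl⟩ := h0 u hu hdu
  obtain ⟨g, hg, hdg⟩ := h1 (f - y • w) (hf'.sub (hw.smul y))
    (by rw [map_sub, hfu, map_smul, sub_self])
  refine ⟨_, hg.map (Submodule.mkQ _), ?_⟩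
  rw [d_map, hdg]
  funext F
  rw [← sub_eq_zero, ← map_sub, Submodule.mkQ_apply, Submodule.Quotient.mk_eq_zero]
  refine Submodule.mem_smul_pointwise_iff_exists _ _ _ |>.mpr ⟨-w F, trivial, ?_⟩
  simp

theorem Acyclic.of_quotSMulTop_succ (hyx : y ∈ Ideal.span (Set.range x)) (hy : IsSMulRegular N y)
    {i : ℕ} (h : Acyclic x (QuotSMulTop y N) (i + 1)) : Acyclic x N i := by
  intro u hu hdu
  obtain ⟨H, hH, hHc⟩ := exists_homotopy (N := N) hyx
  have h1 := hH u
  rw [hdu, map_zero, add_zero] at h1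
  obtain ⟨g, hg, hdg⟩ := h _ ((hHc _ _ hu).map (Submodule.mkQ _)) (by
    rw [d_map, h1]
    funext F
    exact (Submodule.Quotient.mk_eq_zero _).mpr
      (Submodule.mem_smul_pointwise_iff_exists _ _ _ |>.mpr ⟨u F, trivial, rfl⟩))
  obtain ⟨g, hg', rfl⟩ := hg.exists_lift (Submodule.mkQ_surjective _)
  rw [d_map] at hdg
  obtain ⟨w, hw, hfw⟩ := exists_smul_eq_of_mkQ_eq_zero ((hHc _ _ hu).sub (hg'.d x)) (y := y) (by
    funext F
    rw [Pi.sub_apply, map_sub, congrFun hdg F, sub_self, Pi.zero_apply])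
  refine ⟨w, hw, smul_injective hy ?_⟩
  rw [← map_smul, ← hfw, map_sub, d_d, sub_zero, h1]

theorem acyclic_of_lt {i : ℕ} (hi : n < i) : Acyclic x N i := by
  intro f hf _
  have h0 : f = 0 := by
    funext F
    by_contra h
    have h1 := hf F h
    have h2 := F.card_le_univ
    rw [Fintype.card_fin] at h2
    omega
  exact ⟨0, fun F hF => absurd rfl hF, by rw [h0, map_zero]⟩

/-- If the top Koszul homology, which is the socle, vanishes, then some element of the ideal of
`x` is a nonzerodivisor. -/
theorem exists_isSMulRegular [IsNoetherianRing R] [Module.Finite R N] (h : Acyclic x N n) :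
    ∃ y ∈ Ideal.span (Set.range x), IsSMulRegular N y := by
  -- A map from `R / (x)` to `N` is an element of the socle of `N`.
  have key : Subsingleton ((R ⧸ Ideal.span (Set.range x)) →ₗ[R] N) := by
    refine subsingleton_of_forall_eq 0 fun L => ?_
    have hx : ∀ v, x v • L 1 = 0 := by
      intro v
      rw [← map_smul]
      convert map_zero L
      rw [← map_one (Ideal.Quotient.mk _), ← Ideal.Quotient.mk_eq_mk,
        ← Submodule.Quotient.mk_smul, Submodule.Quotient.mk_eq_zero, smul_eq_mul, mul_one]
      exact Ideal.subset_span ⟨v, rfl⟩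
    obtain ⟨g, hg, hdg⟩ := h (fun F => if F = Finset.univ then L 1 else 0)
      (fun F hF => by
        by_cases hF' : F = Finset.univ
        · rw [hF', Finset.card_univ, Fintype.card_fin]
        · exact absurd (if_neg hF') hF)
      (by
        funext G
        refine Finset.sum_eq_zero fun v _ => ?_
        beta_reduce
        split_ifs
        · rw [hx, smul_zero]
        · rw [smul_zero, smul_zero])
    have hg0 : g = 0 := by
      funext F
      by_contra hne
      have h1 := hg F hne
      have h2 := F.card_le_univ
      rw [Fintype.card_fin] at h2
      omega
    have h1 := congrFun hdg Finset.univ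
    rw [hg0, map_zero] at h1
    simp only [Pi.zero_apply, if_true] at h1
    ext
    simpa using h1.symm
  obtain ⟨y, hy, hreg⟩ := IsSMulRegular.subsingleton_linearMap_iff.mp key
  rw [Ideal.annihilator_quotient] at hy
  exact ⟨y, hy, hreg⟩

/-- Passing to the quotient by a nonzerodivisor in the ideal of `x` raises the top nonvanishing
degree of Koszul homology by one. -/
theorem isGreatest_quotSMulTop (hyx : y ∈ Ideal.span (Set.range x)) (hy : IsSMulRegular N y)
    {m : ℕ} (h : IsGreatest {i | ¬ Acyclic x N i} m) :
    IsGreatest {i | ¬ Acyclic x (QuotSMulTop y N) i} (m + 1) := by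
  refine ⟨fun hm => h.1 (hm.of_quotSMulTop_succ hyx hy), fun i hi => ?_⟩
  by_contra hlt
  obtain ⟨i, rfl⟩ : ∃ i', i = i' + 1 := ⟨i - 1, by omega⟩
  refine hi (Acyclic.quotSMulTop hy ?_ ?_)
  · by_contra h1
    have := h.2 h1
    omega
  · by_contra h1
    have := h.2 h1
    omega

theorem nontrivial_of_not_acyclic {i : ℕ} (h : ¬ Acyclic x N i) : Nontrivial N := by
  by_contra hN
  rw [not_nontrivial_iff_subsingleton] at hN
  exact h fun f _ _ => ⟨0, fun F hF => absurd rfl hF, Subsingleton.elim _ _⟩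

end

/-- A regular sequence in the ideal of `x` is bounded in length by the Koszul homology: each element
raises the top nonvanishing degree by one, and that degree is at most `n`. -/
theorem length_add_le (x : Fin n → R) (rs : List R) : ∀ (N : Type*) [AddCommGroup N] [Module R N]
    (m : ℕ), IsGreatest {i | ¬ Acyclic x N i} m → IsRegular N rs →
    (∀ r ∈ rs, r ∈ Ideal.span (Set.range x)) → rs.length + m ≤ n := by
  induction rs with
  | nil =>
    intro N _ _ m hm _ _
    by_contra hlt
    exact hm.1 (acyclic_of_lt (by simpa using hlt))
  | cons y rs ih =>
    intro N _ _ m hm hreg hmem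
    rw [isRegular_cons_iff] at hreg
    have := ih (QuotSMulTop y N) (m + 1)
      (isGreatest_quotSMulTop (hmem y (by simp)) hreg.1 hm) hreg.2 fun r hr => hmem r (by simp [hr])
    rw [List.length_cons]
    omega

/-- As long as the top nonvanishing degree of Koszul homology is less than `n`, a regular sequence
can be continued. -/
theorem exists_isRegular [IsNoetherianRing R] (x : Fin n → R) (t : ℕ) :
    ∀ (N : Type*) [AddCommGroup N] [Module R N] [Module.Finite R N] (m : ℕ),
    IsGreatest {i | ¬ Acyclic x N i} m → m + t = n →
    ∃ rs : List R, IsRegular N rs ∧ (∀ r ∈ rs, r ∈ Ideal.span (Set.range x)) ∧ rs.length = t := by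
  induction t with
  | zero =>
    intro N _ _ _ m hm _
    have := nontrivial_of_not_acyclic hm.1
    exact ⟨[], IsRegular.nil R N, by simp, rfl⟩
  | succ t ih =>
    intro N _ _ _ m hm hmt
    have hn : Acyclic x N n := by
      by_contra h
      have := hm.2 h
      omega
    obtain ⟨y, hy, hreg⟩ := exists_isSMulRegular hn
    obtain ⟨rs, h1, h2, h3⟩ := ih (QuotSMulTop y N) (m + 1) (isGreatest_quotSMulTop hy hreg hm)
      (by omega)
    refine ⟨y :: rs, (isRegular_cons_iff _ _ _).mpr ⟨hreg, h1⟩, ?_, by simp [h3]⟩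
    simpa using ⟨hy, h2⟩

end Koszul

/-- The depth of a finitely generated module is `n` minus the top nonvanishing degree of its
Koszul homology. -/
theorem polyDepth_eq {k : Type*} [Field k] {n : ℕ} (M : Type*) [AddCommGroup M]
    [Module (MvPolynomial (Fin n) k) M] [Module.Finite (MvPolynomial (Fin n) k) M] {p : ℕ}
    (hp : IsGreatest {i | ¬ Koszul.Acyclic (X : Fin n → MvPolynomial (Fin n) k) M i} p) :
    p ≤ n ∧ polyDepth (k := k) (n := n) M = (n - p : ℕ) := by
  have hpn : p ≤ n := by
    by_contra h
    exact hp.1 (Koszul.acyclic_of_lt (by omega))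
  refine ⟨hpn, le_antisymm (iSup₂_le fun rs hrs => ?_) ?_⟩
  · have := Koszul.length_add_le _ rs M p hp hrs.1 hrs.2
    exact_mod_cast (by omega : rs.length ≤ n - p)
  · obtain ⟨rs, h1, h2, h3⟩ := Koszul.exists_isRegular _ (n - p) M p hp (by omega)
    rw [← h3]
    exact le_iSup₂_of_le rs ⟨h1, h2⟩ le_rfl

/-! ### Double complexes with exact rows and columns -/

/-- A first quadrant double complex of abelian groups. The group in position `(p, q)` is the
subgroup `S p q` of an ambient group `A p` that does not depend on `q`. The rows are exact in
positions with `p > 0`, and the columns are exact in positions with `q > 0`. -/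
structure ExactDoubleComplex (A : ℕ → Type*) [∀ p, AddCommGroup (A p)] where
  S : (p : ℕ) → ℕ → AddSubgroup (A p)
  row : (p : ℕ) → A (p + 1) →+ A p
  col : (p : ℕ) → A p →+ A p
  row_mem : ∀ p q c, c ∈ S (p + 1) q → row p c ∈ S p q
  col_mem : ∀ p q c, c ∈ S p (q + 1) → col p c ∈ S p q
  row_row : ∀ p c, row p (row (p + 1) c) = 0
  col_col : ∀ p c, col p (col p c) = 0
  row_col : ∀ p c, row p (col (p + 1) c) = col p (row p c)
  row_exact : ∀ p q, ∀ c ∈ S (p + 1) q, row p c = 0 → ∃ b ∈ S (p + 2) q, row (p + 1) b = c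
  col_exact : ∀ p q, ∀ c ∈ S p (q + 1), col p c = 0 → ∃ b ∈ S p (q + 2), col p b = c

namespace ExactDoubleComplex

variable {A : ℕ → Type*} [∀ p, AddCommGroup (A p)] (C : ExactDoubleComplex A)

/-- The element `c` in position `(p, q)` is a sum of a row boundary and a column boundary. -/
def IsBoundary (p q : ℕ) (c : A p) : Prop :=
  ∃ u ∈ C.S (p + 1) q, ∃ w ∈ C.S p (q + 1), c = C.row p u + C.col p w

/-- The vanishing of the homology, in the column `p` and position `q + 1`, of the complex of
cokernels of the rows, when `p = 0`. -/
def ColVanish (p q : ℕ) : Prop :=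
  ∀ c ∈ C.S p (q + 1), ∀ b ∈ C.S (p + 1) q, C.col p c = C.row p b → C.IsBoundary p (q + 1) c

/-- The vanishing of the homology, in the row `q` and position `p + 1`, of the complex of
cokernels of the columns, when `q = 0`. -/
def RowVanish (p q : ℕ) : Prop :=
  ∀ c ∈ C.S p (q + 1), ∀ b ∈ C.S (p + 1) q, C.col p c = C.row p b → C.IsBoundary (p + 1) q b

theorem colVanish_iff_rowVanish (p q : ℕ) : C.ColVanish p q ↔ C.RowVanish p q := by
  constructor
  · intro h c hc b hb hcb
    obtain ⟨u, hu, w, hw, rfl⟩ := h c hc b hb hcb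
    rw [map_add, C.col_col, add_zero, ← C.row_col, eq_comm, ← sub_eq_zero, ← map_sub] at hcb
    obtain ⟨v, hv, hvb⟩ := C.row_exact p q _ (sub_mem hb (C.col_mem _ _ _ hu)) hcb
    exact ⟨v, hv, u, hu, by rw [hvb]; abel⟩
  · intro h c hc b hb hcb
    obtain ⟨u, hu, w, hw, rfl⟩ := h c hc b hb hcb
    rw [map_add, C.row_row, zero_add, C.row_col, ← sub_eq_zero, ← map_sub] at hcb
    obtain ⟨v, hv, hvb⟩ := C.col_exact p q _ (sub_mem hc (C.row_mem _ _ _ hw)) hcb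
    exact ⟨w, hw, v, hv, by rw [hvb]; abel⟩

/-- In a position with `p, q > 0` the row differential of an element is a column boundary if and
only if its column differential is a row boundary. -/
theorem rowVanish_succ_iff_colVanish_succ (p q : ℕ) :
    C.RowVanish p (q + 1) ↔ C.ColVanish (p + 1) q := by
  constructor
  · intro h c hc b hb hcb
    obtain ⟨a, ha, hac⟩ := C.col_exact p q (C.row p c) (C.row_mem _ _ _ hc) (by
      rw [← C.row_col, hcb, C.row_row])
    exact h a ha c hc hac
  · intro h c hc b hb hcb
    obtain ⟨a, ha, hac⟩ := C.row_exact p q (C.col (p + 1) b) (C.col_mem _ _ _ hb) (by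
      rw [C.row_col, ← hcb, C.col_col])
    exact h b hb a ha hac.symm

theorem colVanish_iff_of_add (p q i : ℕ) : C.ColVanish p (q + i) ↔ C.RowVanish (p + i) q := by
  induction i generalizing p with
  | zero => exact C.colVanish_iff_rowVanish p q
  | succ i ih =>
    rw [colVanish_iff_rowVanish, ← add_assoc, rowVanish_succ_iff_colVanish_succ, ih,
      Nat.add_right_comm, add_assoc]

/-- The homology of the complex of cokernels of the rows vanishes in a given degree if and only if
that of the complex of cokernels of the columns does. -/
theorem colVanish_zero_iff_rowVanish_zero (i : ℕ) : C.ColVanish 0 i ↔ C.RowVanish i 0 := by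
  simpa using C.colVanish_iff_of_add 0 0 i

end ExactDoubleComplex

/-! ### Multigraded strands of Koszul complexes -/

namespace Koszul

variable {n : ℕ} {k : Type*} [Field k]

/-- The exponent of the squarefree monomial `∏ i ∈ F, X i`. -/
def expo (F : Finset (Fin n)) : Fin n →₀ ℕ := Finsupp.indicator F fun _ _ => 1

theorem expo_apply (F : Finset (Fin n)) (i : Fin n) : expo F i = if i ∈ F then 1 else 0 := by
  simp [expo, Finsupp.indicator_apply]

theorem support_expo (F : Finset (Fin n)) : (expo F).support = F := by
  ext i
  simp [expo_apply]

theorem support_expo_sub (V F : Finset (Fin n)) : (expo V - expo F).support = V \ F := by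
  ext u
  simp only [Finsupp.mem_support_iff, Finsupp.tsub_apply, expo_apply, Finset.mem_sdiff]
  split_ifs <;> simp_all

theorem expo_le_iff {F : Finset (Fin n)} {a : Fin n →₀ ℕ} : expo F ≤ a ↔ F ⊆ a.support := by
  constructor
  · intro h i hi
    have := h i
    rw [expo_apply, if_pos hi] at this
    simp; omega
  · intro h i
    rw [expo_apply]
    split_ifs with hi
    · have := h hi
      simp at this; omega
    · exact Nat.zero_le _

theorem degree_expo (F : Finset (Fin n)) : (expo F).degree = F.card := by
  rw [Finsupp.degree_eq_sum]
  simp [expo_apply]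

theorem expo_insert {F : Finset (Fin n)} {v : Fin n} (h : v ∉ F) :
    expo (insert v F) = expo F + Finsupp.single v 1 := by
  ext i
  simp only [expo_apply, Finsupp.add_apply, Finset.mem_insert, Finsupp.single_apply]
  by_cases hi : v = i
  · subst hi; simp [h]
  · simp [hi, Ne.symm hi]

theorem prod_X_eq (F : Finset (Fin n)) :
    ∏ i ∈ F, (X i : MvPolynomial (Fin n) k) = monomial (expo F) 1 := by
  induction F using Finset.induction_on with
  | empty =>
    have : expo (∅ : Finset (Fin n)) = 0 := by ext; simp [expo_apply]
    simp [this]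
  | insert v F hv ih =>
    rw [Finset.prod_insert hv, ih, expo_insert hv, X, monomial_mul, one_mul, add_comm]

/-- A polynomial is in the Stanley--Reisner ideal if and only if the supports of its monomials are
nonfaces. -/
theorem mem_stanleyReisnerIdeal {Δ : LowerSet (Finset (Fin n))} {p : MvPolynomial (Fin n) k} :
    p ∈ SComplex.stanleyReisnerIdeal k Δ ↔ ∀ e, e.support ∈ Δ → coeff e p = 0 := by
  have h : {p : MvPolynomial (Fin n) k | ∃ F : Finset (Fin n), F ∉ Δ ∧ p = ∏ i ∈ F, X i} =
      (fun s => monomial s 1) '' (expo '' {F | F ∉ Δ}) := by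
    ext p
    simp [prod_X_eq, eq_comm]
  rw [SComplex.stanleyReisnerIdeal, h, mem_ideal_span_monomial_image]
  refine forall_congr' fun e => ?_
  rw [mem_support_iff, ← not_imp_not, not_not]
  refine imp_congr_left ?_
  simp only [Set.mem_image, Set.mem_ofPred_eq, exists_exists_and_eq_and, expo_le_iff, not_exists,
    not_and]
  exact ⟨fun h => by_contra fun h' => h _ h' subset_rfl, fun h F hF hFe => hF (Δ.lower hFe h)⟩

/-- The component of multidegree `a` of an element of the Koszul complex of the variables over
`k[x_1, …, x_n]`, the basis vector `e_F` having the multidegree of `∏ i ∈ F, X i`. -/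
def strand (a : Fin n →₀ ℕ) :
    (Finset (Fin n) → MvPolynomial (Fin n) k) →ₗ[k] (Finset (Fin n) → k) where
  toFun f F := if F ⊆ a.support then coeff (a - expo F) (f F) else 0
  map_add' f g := by
    funext F
    by_cases h : F ⊆ a.support <;> simp [h]
  map_smul' c f := by
    funext F
    by_cases h : F ⊆ a.support <;> simp [h]

theorem strand_apply (a : Fin n →₀ ℕ) (f : Finset (Fin n) → MvPolynomial (Fin n) k)
    (F : Finset (Fin n)) :
    strand a f F = if F ⊆ a.support then coeff (a - expo F) (f F) else 0 := rfl

theorem coeff_eq_strand (f : Finset (Fin n) → MvPolynomial (Fin n) k) (F : Finset (Fin n))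
    (e : Fin n →₀ ℕ) : coeff e (f F) = strand (e + expo F) f F := by
  rw [strand_apply, if_pos (expo_le_iff.mp le_add_self), add_tsub_cancel_right]

theorem strand_d (a : Fin n →₀ ℕ) (f : Finset (Fin n) → MvPolynomial (Fin n) k) :
    strand a (d (X (R := k)) f) = SComplex.boundary k (strand a f) := by
  rw [boundary_eq_d]
  funext G
  rw [strand_apply, d_apply, d_apply]
  split_ifs with hG
  · rw [coeff_sum]
    refine Finset.sum_congr rfl fun v hv => ?_
    have hv : v ∉ G := by simpa using hv
    have hs : sign (MvPolynomial (Fin n) k) G v = C (sign k G v) := by simp [sign]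
    rw [hs, smul_eq_mul, coeff_C_mul, smul_eq_mul, coeff_X_mul', one_smul, smul_eq_mul,
      strand_apply]
    congr 1
    have h1 : v ∈ (a - expo G).support ↔ insert v G ⊆ a.support := by
      rw [Finset.insert_subset_iff]
      simp [expo_apply, hv, hG]
    rw [if_congr h1 rfl rfl, expo_insert hv, tsub_add_eq_tsub_tsub]
  · refine (Finset.sum_eq_zero fun v _ => ?_).symm
    rw [strand_apply, if_neg fun h => hG ((Finset.subset_insert v G).trans h), smul_zero, smul_zero]

/-- The element of the Koszul complex that is homogeneous of multidegree `a` and has the given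
coefficients. -/
def ofStrand (a : Fin n →₀ ℕ) (ψ : Finset (Fin n) → k) :
    Finset (Fin n) → MvPolynomial (Fin n) k :=
  fun F => if F ⊆ a.support then monomial (a - expo F) (ψ F) else 0

theorem strand_ofStrand (a b : Fin n →₀ ℕ) (ψ : Finset (Fin n) → k)
    (hψ : ∀ F, ψ F ≠ 0 → F ⊆ a.support) :
    strand b (ofStrand a ψ) = if a = b then ψ else 0 := by
  funext F
  rw [strand_apply, ofStrand]
  by_cases hab : a = b
  · subst hab
    by_cases hF : F ⊆ a.support
    · simp [hF]
    · rw [if_neg hF, if_pos rfl]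
      by_contra h
      exact hF (hψ F (Ne.symm h))
  · rw [if_neg hab]
    by_cases hb : F ⊆ b.support
    · rw [if_pos hb]
      by_cases ha : F ⊆ a.support
      · rw [if_pos ha, coeff_monomial, if_neg, Pi.zero_apply]
        intro h
        refine hab ?_
        rw [← tsub_add_cancel_of_le (expo_le_iff.mpr ha), h,
          tsub_add_cancel_of_le (expo_le_iff.mpr hb)]
      · simp [ha]
    · simp [hb]

/-- The elements of homological degree `i` of the Koszul complex of the variables all of whose
multidegrees are in `D`. -/
def IsChainIn (D : Set (Fin n →₀ ℕ)) (i : ℕ) (f : Finset (Fin n) → MvPolynomial (Fin n) k) :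
    Prop :=
  ∀ F e, coeff e (f F) ≠ 0 → F.card = i ∧ e + expo F ∈ D

theorem isChainIn_iff {D : Set (Fin n →₀ ℕ)} {i : ℕ}
    {f : Finset (Fin n) → MvPolynomial (Fin n) k} :
    IsChainIn D i f ↔ ∀ a F, strand a f F ≠ 0 → F.card = i ∧ a ∈ D := by
  constructor
  · intro h a F hF
    rw [strand_apply] at hF
    split_ifs at hF with hs
    · have := h F _ hF
      rwa [tsub_add_cancel_of_le (expo_le_iff.mpr hs)] at this
    · exact absurd rfl hF
  · intro h F e he
    rw [coeff_eq_strand] at he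
    exact h _ F he

theorem IsChainIn.d {D : Set (Fin n →₀ ℕ)} {i : ℕ}
    {f : Finset (Fin n) → MvPolynomial (Fin n) k} (hf : IsChainIn D (i + 1) f) :
    IsChainIn D i (Koszul.d (X (R := k)) f) := by
  rw [isChainIn_iff] at hf ⊢
  intro a F hF
  rw [strand_d, boundary_eq_d] at hF
  refine ⟨IsChain.d (fun G hG => (hf a G hG).1) _ F hF, ?_⟩
  by_contra ha
  have h0 : strand a f = 0 := by
    funext G
    by_contra h
    exact ha (hf a G h).2
  rw [h0, map_zero] at hF
  exact hF rfl

theorem IsChainIn.isChain {D : Set (Fin n →₀ ℕ)} {i : ℕ}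
    {f : Finset (Fin n) → MvPolynomial (Fin n) k} (hf : IsChainIn D i f) : IsChain i f := by
  intro F hF
  obtain ⟨e, he⟩ := ne_zero_iff.mp hF
  exact (hf F e he).1

/-- The vanishing of the `i`-th Koszul homology of the variables with coefficients in
`k[x_1, …, x_n] / I_Δ` in all multidegrees that are in `D`. -/
def AcyclicIn (k : Type*) [Field k] (Δ : LowerSet (Finset (Fin n))) (D : Set (Fin n →₀ ℕ))
    (i : ℕ) : Prop :=
  ∀ f : Finset (Fin n) → MvPolynomial (Fin n) k, IsChainIn D i f →
    (∀ F, d (X (R := k)) f F ∈ SComplex.stanleyReisnerIdeal k Δ) →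
    ∃ g, IsChainIn D (i + 1) g ∧ ∀ F, f F - d (X (R := k)) g F ∈ SComplex.stanleyReisnerIdeal k Δ

/-- The vanishing of the `i`-th homology of the strand of multidegree `a` of the Koszul complex of
`k[x_1, …, x_n] / I_Δ`. This strand has a basis indexed by the sets `F ⊆ a.support` for which the
support of `a - expo F` is a face. -/
def StrandAcyclic (k : Type*) [Field k] (Δ : LowerSet (Finset (Fin n))) (a : Fin n →₀ ℕ) (i : ℕ) :
    Prop :=
  ∀ φ : Finset (Fin n) → k, (∀ F, φ F ≠ 0 → F.card = i ∧ F ⊆ a.support) →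
    (∀ G, G ⊆ a.support → (a - expo G).support ∈ Δ → SComplex.boundary k φ G = 0) →
    ∃ ψ : Finset (Fin n) → k, (∀ F, ψ F ≠ 0 → F.card = i + 1 ∧ F ⊆ a.support) ∧
      ∀ F, F ⊆ a.support → (a - expo F).support ∈ Δ → φ F = SComplex.boundary k ψ F

theorem forall_mem_iff_strand {Δ : LowerSet (Finset (Fin n))}
    {f : Finset (Fin n) → MvPolynomial (Fin n) k} :
    (∀ F, f F ∈ SComplex.stanleyReisnerIdeal k Δ) ↔
      ∀ a F, F ⊆ a.support → (a - expo F).support ∈ Δ → strand a f F = 0 := by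
  simp only [mem_stanleyReisnerIdeal]
  constructor
  · intro h a F hF ha
    rw [strand_apply, if_pos hF]
    exact h F _ ha
  · intro h F e he
    rw [coeff_eq_strand]
    exact h _ F (expo_le_iff.mp le_add_self) (by rwa [add_tsub_cancel_right])

theorem exists_finset_strand (f : Finset (Fin n) → MvPolynomial (Fin n) k) :
    ∃ A : Finset (Fin n →₀ ℕ), ∀ a ∉ A, strand a f = 0 := by
  classical
  refine ⟨Finset.univ.biUnion fun F => (f F).support.image fun e => e + expo F, fun a ha => ?_⟩
  funext F
  by_contra h
  rw [strand_apply] at h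
  split_ifs at h with hF
  · refine ha (Finset.mem_biUnion.mpr ⟨F, Finset.mem_univ F, Finset.mem_image.mpr
      ⟨a - expo F, mem_support_iff.mpr h, tsub_add_cancel_of_le (expo_le_iff.mpr hF)⟩⟩)
  · exact h rfl

theorem acyclicIn_iff {Δ : LowerSet (Finset (Fin n))} {D : Set (Fin n →₀ ℕ)} {i : ℕ} :
    AcyclicIn k Δ D i ↔ ∀ a ∈ D, StrandAcyclic k Δ a i := by
  classical
  constructor
  · intro h a ha φ hφ hdφ
    have hs := fun b => strand_ofStrand a b φ fun F hF => (hφ F hF).2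
    obtain ⟨g, hg, hfg⟩ := h (ofStrand a φ) (isChainIn_iff.mpr fun b F hF => by
        rw [hs] at hF
        split_ifs at hF with hab
        · subst hab
          exact ⟨(hφ F hF).1, ha⟩
        · exact absurd rfl hF) (forall_mem_iff_strand.mpr fun b F hF hb => by
        rw [strand_d, hs]
        split_ifs with hab
        · subst hab
          exact hdφ F hF hb
        · rw [map_zero, Pi.zero_apply])
    refine ⟨strand a g, fun F hF => ⟨(isChainIn_iff.mp hg a F hF).1, ?_⟩, fun F hF hFa => ?_⟩
    · by_contra h'
      exact hF (if_neg h')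
    · have := (forall_mem_iff_strand (f := ofStrand a φ - d (X (R := k)) g)).mp hfg a F hF hFa
      rw [map_sub, strand_d, hs, if_pos rfl, Pi.sub_apply, sub_eq_zero] at this
      exact this
  · intro h f hf hdf
    rw [isChainIn_iff] at hf
    rw [forall_mem_iff_strand] at hdf
    have key : ∀ a, ∃ ψ : Finset (Fin n) → k,
        (∀ F, ψ F ≠ 0 → F.card = i + 1 ∧ F ⊆ a.support ∧ a ∈ D) ∧
        ∀ F, F ⊆ a.support → (a - expo F).support ∈ Δ →
          strand a f F = SComplex.boundary k ψ F := by
      intro a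
      by_cases ha : a ∈ D
      · obtain ⟨ψ, h1, h2⟩ := h a ha (strand a f) (fun F hF => ⟨(hf a F hF).1, by
          by_contra h'
          exact hF (if_neg h')⟩) (fun G hG hGa => by
            rw [← strand_d]
            exact hdf a G hG hGa)
        exact ⟨ψ, fun F hF => ⟨(h1 F hF).1, (h1 F hF).2, ha⟩, h2⟩
      · refine ⟨0, fun F hF => absurd rfl hF, fun F _ _ => ?_⟩
        rw [map_zero, Pi.zero_apply]
        by_contra h'
        exact ha (hf a F h').2
    choose ψ hψ hfψ using key
    obtain ⟨A, hA⟩ := exists_finset_strand f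
    have hs : ∀ b, strand b (∑ a ∈ A, ofStrand a (ψ a)) = if b ∈ A then ψ b else 0 := by
      intro b
      rw [map_sum, Finset.sum_congr rfl fun a _ =>
        strand_ofStrand a b (ψ a) fun F hF => (hψ a F hF).2.1]
      simp
    refine ⟨∑ a ∈ A, ofStrand a (ψ a), isChainIn_iff.mpr fun b F hF => ?_,
      (forall_mem_iff_strand (f := f - d (X (R := k)) (∑ a ∈ A, ofStrand a (ψ a)))).mpr
        fun b F hF hb => ?_⟩
    · rw [hs] at hF
      split_ifs at hF
      · exact ⟨(hψ b F hF).1, (hψ b F hF).2.2⟩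
      · exact absurd rfl hF
    · rw [map_sub, strand_d, hs, Pi.sub_apply]
      split_ifs with hbA
      · rw [hfψ b F hF hb, sub_self]
      · rw [hA b hbA, map_zero, sub_self]

/-- If removing `v` from `F` does not change whether the strand has a basis vector for `F`, then
the cone over `v` is a contracting homotopy of the strand. -/
theorem strandAcyclic_of_cone {Δ : LowerSet (Finset (Fin n))} {a : Fin n →₀ ℕ} {v : Fin n}
    (hv : v ∈ a.support) (h : ∀ F, F ⊆ a.support → v ∈ F → (a - expo F).support ∈ Δ →
      (a - expo (F.erase v)).support ∈ Δ) (i : ℕ) : StrandAcyclic k Δ a i := by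
  intro φ hφ hdφ
  refine ⟨cone k v φ, fun F hF => ?_, fun F hF hFa => ?_⟩
  · refine ⟨IsChain.cone (R := k) (fun F hF => (hφ F hF).1) v F hF, ?_⟩
    rw [cone_apply] at hF
    split_ifs at hF with hvF
    · rw [← Finset.insert_erase hvF]
      exact Finset.insert_subset hv (hφ _ fun h' => hF (by rw [h', smul_zero])).2
    · exact absurd rfl hF
  · have h1 := congrFun (d_cone_add_cone_d (fun _ => (1 : k)) v φ) F
    rw [one_smul, Pi.add_apply, cone_apply, ← boundary_eq_d] at h1
    rw [← h1, add_eq_left]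
    split_ifs with hvF
    · rw [hdφ _ ((Finset.erase_subset v F).trans hF) (h F hF hvF hFa), smul_zero]
    · rfl

/-- The strands of multidegrees that are not squarefree are acyclic. -/
theorem strandAcyclic_of_two_le (Δ : LowerSet (Finset (Fin n))) {a : Fin n →₀ ℕ} {v : Fin n}
    (hv : 2 ≤ a v) (i : ℕ) : StrandAcyclic k Δ a i := by
  refine strandAcyclic_of_cone (v := v) (by simp; omega) (fun F _ hvF h => ?_) i
  convert h using 1
  ext u
  by_cases hu : u = v
  · subst hu
    simp only [Finsupp.mem_support_iff, Finsupp.tsub_apply, expo_apply]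
    split_ifs <;> omega
  · simp [expo_apply, hu]

theorem strandAcyclic_top {a : Fin n →₀ ℕ} (ha : a ≠ 0) (i : ℕ) : StrandAcyclic k ⊤ a i := by
  obtain ⟨v, hv⟩ := Finsupp.support_nonempty_iff.mpr ha
  exact strandAcyclic_of_cone hv (fun _ _ _ _ => LowerSet.mem_top) i

theorem strandAcyclic_zero (Δ : LowerSet (Finset (Fin n))) (i : ℕ) :
    StrandAcyclic k Δ 0 (i + 1) := by
  intro φ hφ _
  refine ⟨0, fun F hF => absurd rfl hF, fun F _ _ => ?_⟩
  rw [map_zero, Pi.zero_apply]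
  by_contra h
  obtain ⟨h1, h2⟩ := hφ F h
  have := Finset.card_le_card h2
  rw [Finsupp.support_zero, Finset.card_empty] at this
  omega

theorem stanleyReisnerIdeal_top :
    SComplex.stanleyReisnerIdeal k (⊤ : LowerSet (Finset (Fin n))) = ⊥ := by
  simp [SComplex.stanleyReisnerIdeal]

/-- The Koszul complex of the variables over the polynomial ring is exact in positive homological
degree, in each set of multidegrees. -/
theorem exists_d_eq {D : Set (Fin n →₀ ℕ)} {i : ℕ} {f : Finset (Fin n) → MvPolynomial (Fin n) k}
    (hf : IsChainIn D (i + 1) f) (h : d (X (R := k)) f = 0) :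
    ∃ g, IsChainIn D (i + 2) g ∧ d (X (R := k)) g = f := by
  obtain ⟨g, hg, hfg⟩ := (acyclicIn_iff (Δ := ⊤)).mpr (fun a _ => by
    by_cases ha : a = 0
    · exact ha ▸ strandAcyclic_zero ⊤ i
    · exact strandAcyclic_top ha (i + 1)) f hf fun F => by rw [h]; exact zero_mem _
  refine ⟨g, hg, funext fun F => ?_⟩
  have := hfg F
  rw [stanleyReisnerIdeal_top, Ideal.mem_bot, sub_eq_zero] at this
  exact this.symm

/-- A polynomial, in homological degree zero of the Koszul complex, is a boundary if its constant
coefficient is zero. -/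
theorem exists_d_eq_of_constantCoeff {D : Set (Fin n →₀ ℕ)}
    {f : Finset (Fin n) → MvPolynomial (Fin n) k} (hf : IsChainIn D 0 f)
    (h : constantCoeff (f ∅) = 0) : ∃ g, IsChainIn D 1 g ∧ d (X (R := k)) g = f := by
  have h0 : IsChainIn (D \ {0}) 0 f := by
    intro F e he
    obtain ⟨h1, h2⟩ := hf F e he
    refine ⟨h1, h2, fun h3 => he ?_⟩
    obtain rfl := Finset.card_eq_zero.mp h1
    obtain rfl := (add_eq_zero.mp h3).1
    exact h
  obtain ⟨g, hg, hfg⟩ := (acyclicIn_iff (Δ := ⊤)).mpr (fun a ha => strandAcyclic_top ha.2 0) f h0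
    fun F => by
      rw [hf.isChain.d_eq_zero]
      exact zero_mem _
  refine ⟨g, fun F e he => ⟨(hg F e he).1, (hg F e he).2.1⟩, funext fun F => ?_⟩
  have := hfg F
  rw [stanleyReisnerIdeal_top, Ideal.mem_bot, sub_eq_zero] at this
  exact this.symm

end Koszul

/-! ### Betti numbers and Koszul homology -/

theorem finrank_quotient_submoduleOf_eq_zero_iff {k V : Type*} [Field k] [AddCommGroup V]
    [Module k V] [FiniteDimensional k V] (P Q : Submodule k V) :
    Module.finrank k (P ⧸ Q.submoduleOf P) = 0 ↔ P ≤ Q := by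
  rw [Module.finrank_zero_iff, Submodule.Quotient.subsingleton_iff,
    Submodule.submoduleOf, Submodule.comap_subtype_eq_top]

namespace GradedFreeResolution

open Koszul

variable {k : Type*} [Field k] {n : ℕ}

section

variable {I : Ideal (MvPolynomial (Fin n) k)} (F : GradedFreeResolution I)

/-- The part of internal degree `j` of the tensor product of `F_p` and the degree `q` term of the
Koszul complex of the variables. -/
def part (j p q : ℕ) :
    AddSubgroup (Finset (Fin n) → Fin (F.rank p) → MvPolynomial (Fin n) k) where
  carrier := {f | ∀ a, IsChainIn {b | b.degree + F.deg p a = j} q fun G => f G a}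
  zero_mem' := fun a G e he => absurd (coeff_zero e) he
  add_mem' := by
    intro f g hf hg a G e he
    by_cases h : coeff e (f G a) = 0
    · exact hg a G e fun h' => he (by simp [h, h'])
    · exact hf a G e h
  neg_mem' := by
    intro f hf a G e he
    exact hf a G e fun h => he (by simp [h])

variable {F}

theorem mem_part {j p q : ℕ} {f : Finset (Fin n) → Fin (F.rank p) → MvPolynomial (Fin n) k} :
    f ∈ F.part j p q ↔ ∀ a G e, coeff e (f G a) ≠ 0 →
      G.card = q ∧ e.degree + q + F.deg p a = j := by
  refine forall₄_congr fun a G e _ => and_congr_right fun h => ?_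
  rw [Set.mem_ofPred_eq, map_add, degree_expo, h]

theorem eq_zero_of_mem_part {j p q : ℕ}
    {f : Finset (Fin n) → Fin (F.rank p) → MvPolynomial (Fin n) k} (hf : f ∈ F.part j p q)
    {G : Finset (Fin n)} (hG : G.card ≠ q) : f G = 0 := by
  funext a
  ext e
  by_contra h
  exact hG (mem_part.mp hf a G e h).1

theorem d_apply_eq {p : ℕ} (f : Finset (Fin n) → Fin (F.rank p) → MvPolynomial (Fin n) k)
    (G : Finset (Fin n)) (a : Fin (F.rank p)) :
    Koszul.d (X (R := k)) f G a = Koszul.d (X (R := k)) (fun G => f G a) G :=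
  (congrFun (d_map (X (R := k)) (LinearMap.proj (φ := fun _ => MvPolynomial (Fin n) k) a) f) G).symm

theorem exists_coeff_ne_zero_of_sum_mul {ι : Type*} [Fintype ι]
    {f g : ι → MvPolynomial (Fin n) k} {e : Fin n →₀ ℕ} (h : coeff e (∑ b, f b * g b) ≠ 0) :
    ∃ b x y, x + y = e ∧ coeff x (f b) ≠ 0 ∧ coeff y (g b) ≠ 0 := by
  rw [coeff_sum] at h
  obtain ⟨b, -, hb⟩ := Finset.exists_ne_zero_of_sum_ne_zero h
  rw [coeff_mul] at hb
  obtain ⟨x, hx, hx'⟩ := Finset.exists_ne_zero_of_sum_ne_zero hb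
  exact ⟨b, x.1, x.2, by simpa using hx, left_ne_zero_of_mul hx', right_ne_zero_of_mul hx'⟩

theorem row_mem_part {j p q : ℕ}
    {f : Finset (Fin n) → Fin (F.rank (p + 1)) → MvPolynomial (Fin n) k}
    (hf : f ∈ F.part j (p + 1) q) : (fun G => (F.d p).mulVecLin (f G)) ∈ F.part j p q := by
  rw [mem_part] at hf ⊢
  intro a G e he
  obtain ⟨b, x, y, rfl, hx, hy⟩ := exists_coeff_ne_zero_of_sum_mul he
  have h1 := F.d_homogeneous p a b x (mem_support_iff.mpr hx)
  have h2 := hf b G y hy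
  rw [map_add]
  exact ⟨h2.1, by omega⟩

theorem col_mem_part {j p q : ℕ}
    {f : Finset (Fin n) → Fin (F.rank p) → MvPolynomial (Fin n) k}
    (hf : f ∈ F.part j p (q + 1)) : Koszul.d (X (R := k)) f ∈ F.part j p q := by
  intro a
  simp only [d_apply_eq]
  exact (hf a).d

theorem comp_mem_part {j p q : ℕ} (hqj : q ≤ j)
    (w : Finset (Fin n) → Fin (F.rank p) → MvPolynomial (Fin n) k) :
    (fun G => if G.card = q then comp (F.deg p) (j - q) (w G) else 0) ∈ F.part j p q := by
  rw [mem_part]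
  intro a G e he
  split_ifs at he with hG
  · rw [coeff_comp] at he
    split_ifs at he with h
    · exact ⟨hG, by omega⟩
    · exact absurd rfl he
  · exact absurd (coeff_zero e) he

theorem comp_eq_self {j p q : ℕ} {c : Finset (Fin n) → Fin (F.rank p) → MvPolynomial (Fin n) k}
    (hc : c ∈ F.part j p q) (G : Finset (Fin n)) : comp (F.deg p) (j - q) (c G) = c G := by
  funext a
  ext e
  rw [coeff_comp]
  split_ifs with h
  · rfl
  · by_contra hne
    have := mem_part.mp hc a G e (Ne.symm hne)
    omega

/-- A chain of degree `j` that is the image of some chain is the image of a chain of degree `j`. -/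
theorem exists_row_eq {j p q : ℕ} {c : Finset (Fin n) → Fin (F.rank p) → MvPolynomial (Fin n) k}
    (hc : c ∈ F.part j p q) (h : ∀ G, c G ∈ LinearMap.range (F.d p).mulVecLin) :
    ∃ b ∈ F.part j (p + 1) q, (fun G => (F.d p).mulVecLin (b G)) = c := by
  choose w hw using h
  by_cases hqj : q ≤ j
  · refine ⟨_, comp_mem_part hqj w, funext fun G => ?_⟩
    split_ifs with hG
    · rw [mulVec_comp (F.d_homogeneous p), hw, comp_eq_self hc]
    · rw [map_zero, eq_zero_of_mem_part hc hG]
  · refine ⟨0, zero_mem _, funext fun G => ?_⟩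
    rw [Pi.zero_apply, map_zero]
    funext a
    ext e
    by_contra hne
    have := mem_part.mp hc a G e (Ne.symm hne)
    omega

theorem exists_col_eq {j p q : ℕ} {c : Finset (Fin n) → Fin (F.rank p) → MvPolynomial (Fin n) k}
    (hc : c ∈ F.part j p (q + 1)) (h : Koszul.d (X (R := k)) c = 0) :
    ∃ b ∈ F.part j p (q + 2), Koszul.d (X (R := k)) b = c := by
  have key : ∀ a, ∃ g, IsChainIn {b | b.degree + F.deg p a = j} (q + 2) g ∧
      Koszul.d (X (R := k)) g = fun G => c G a := fun a => exists_d_eq (hc a) (by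
    funext G
    rw [← d_apply_eq, h]; rfl)
  choose g hg hgc using key
  refine ⟨fun G a => g a G, hg, ?_⟩
  funext G a
  rw [d_apply_eq]
  exact congrFun (hgc a) G

variable (F)

/-- The part of internal degree `j` of the tensor product of the resolution with the Koszul complex
of the variables. -/
def koszulDoubleComplex (j : ℕ) : ExactDoubleComplex
    fun p => Finset (Fin n) → Fin (F.rank p) → MvPolynomial (Fin n) k where
  S := F.part j
  row _ :=
    { toFun := fun f G => (F.d _).mulVecLin (f G)
      map_zero' := funext fun _ => map_zero _
      map_add' := fun _ _ => funext fun _ => map_add _ _ _ }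
  col _ := (Koszul.d (X (R := k))).toAddMonoidHom
  row_mem _ _ _ := row_mem_part
  col_mem _ _ _ := col_mem_part
  row_row _ c := funext fun G => (F.exact_succ _).apply_apply_eq_zero (c G)
  col_col _ _ := d_d _ _
  row_col _ c := (d_map _ (F.d _).mulVecLin c).symm
  row_exact _ _ c hc h := exists_row_eq hc fun G => (F.exact_succ _ (c G)).mp (congrFun h G)
  col_exact _ _ _ := exists_col_eq

variable {F}

/-- The constant coefficients of a chain of degree `j`, as an element of `(F_p ⊗ k)_j`. -/
def const (F : GradedFreeResolution I) (j p : ℕ)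
    (b : Finset (Fin n) → Fin (F.rank p) → MvPolynomial (Fin n) k) :
    {a : Fin (F.rank p) // F.deg p a = j} → k :=
  fun a => constantCoeff (b ∅ a)

theorem exists_const_eq {j p : ℕ} (v : {a : Fin (F.rank p) // F.deg p a = j} → k) :
    ∃ b ∈ F.part j p 0, F.const j p b = v := by
  classical
  refine ⟨fun G a => if h : F.deg p a = j then if G = ∅ then C (v ⟨a, h⟩) else 0 else 0, ?_, ?_⟩
  · rw [mem_part]
    intro a G e he
    split_ifs at he with h hG
    · subst hG
      rw [coeff_C] at he
      split_ifs at he with h0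
      · subst h0
        simpa using h
      · exact absurd rfl he
    · exact absurd (coeff_zero e) he
    · exact absurd (coeff_zero e) he
  · funext a
    simp [const, a.2]

/-- The kernel of `(F_p)_j → (F_p ⊗ k)_j` consists of the Koszul boundaries. -/
theorem const_eq_zero_iff {j p : ℕ} {b : Finset (Fin n) → Fin (F.rank p) → MvPolynomial (Fin n) k}
    (hb : b ∈ F.part j p 0) :
    F.const j p b = 0 ↔ ∃ c ∈ F.part j p 1, Koszul.d (X (R := k)) c = b := by
  constructor
  · intro h
    have key : ∀ a, ∃ g, IsChainIn {b | b.degree + F.deg p a = j} 1 g ∧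
        Koszul.d (X (R := k)) g = fun G => b G a := fun a =>
      exists_d_eq_of_constantCoeff (hb a) (by
        by_cases ha : F.deg p a = j
        · exact congrFun h ⟨a, ha⟩
        · by_contra hne
          have := mem_part.mp hb a ∅ 0 hne
          simp at this
          exact ha this)
    choose g hg hgb using key
    refine ⟨fun G a => g a G, hg, ?_⟩
    funext G a
    rw [d_apply_eq]
    exact congrFun (hgb a) G
  · rintro ⟨c, -, rfl⟩
    funext a
    rw [const, d_apply_eq, Koszul.d_apply, map_sum]
    exact Finset.sum_eq_zero fun v _ => by simp

/-- Only the generators of degree `j` of `F_{p+1}` contribute to the constant coefficients of the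
image at a generator of degree `j` of `F_p`, because the matrix entries are homogeneous. -/
theorem const_row {j p : ℕ} {b : Finset (Fin n) → Fin (F.rank (p + 1)) → MvPolynomial (Fin n) k} :
    F.const j p (fun G => (F.d p).mulVecLin (b G)) = F.tensorD p j (F.const j (p + 1) b) := by
  classical
  funext a
  change constantCoeff (∑ c, F.d p a c * b ∅ c) =
    ∑ c : {c // F.deg (p + 1) c = j}, constantCoeff (F.d p a c) * constantCoeff (b ∅ c)
  rw [map_sum, ← Finset.sum_subtype (Finset.univ.filter fun c => F.deg (p + 1) c = j) (by simp)
    fun c => constantCoeff (F.d p a c) * constantCoeff (b ∅ c), Finset.sum_filter_of_ne]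
  · simp only [map_mul]
  · intro c _ hc
    have := F.d_homogeneous p a c 0 (mem_support_iff.mpr (left_ne_zero_of_mul hc))
    rw [map_zero, zero_add] at this
    rw [← this, a.2]

theorem isBoundary_iff_const {j p : ℕ}
    {b : Finset (Fin n) → Fin (F.rank p) → MvPolynomial (Fin n) k} (hb : b ∈ F.part j p 0) :
    (F.koszulDoubleComplex j).IsBoundary p 0 b ↔
      F.const j p b ∈ LinearMap.range (F.tensorD p j) := by
  have hadd : ∀ f g : Finset (Fin n) → Fin (F.rank p) → MvPolynomial (Fin n) k,
      F.const j p (f + g) = F.const j p f + F.const j p g :=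
    fun f g => funext fun a => map_add _ _ _
  constructor
  · rintro ⟨u, hu, w, hw, rfl⟩
    refine ⟨F.const j (p + 1) u, ?_⟩
    rw [← const_row]
    change _ = F.const j p ((fun G => (F.d p).mulVecLin (u G)) + Koszul.d (X (R := k)) w)
    rw [hadd, (const_eq_zero_iff (col_mem_part hw)).mpr ⟨w, hw, rfl⟩, add_zero]
  · rintro ⟨z, hz⟩
    obtain ⟨u, hu, rfl⟩ := exists_const_eq z
    have h := hadd (fun G => (F.d p).mulVecLin (u G)) (b - fun G => (F.d p).mulVecLin (u G))
    rw [add_sub_cancel, const_row, ← hz, left_eq_add,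
      const_eq_zero_iff (sub_mem hb (row_mem_part hu))] at h
    obtain ⟨w, hw, hwb⟩ := h
    exact ⟨u, hu, w, hw, (sub_eq_iff_eq_add'.mp hwb.symm)⟩

theorem betti_eq_zero_iff (i j : ℕ) :
    F.betti i j = 0 ↔ F.tensorCycles i j ≤ LinearMap.range (F.tensorD i j) :=
  finrank_quotient_submoduleOf_eq_zero_iff _ _

theorem betti_zero_eq_zero_iff (j : ℕ) :
    F.betti 0 j = 0 ↔ ∀ b ∈ F.part j 0 0, (F.koszulDoubleComplex j).IsBoundary 0 0 b := by
  rw [betti_eq_zero_iff]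
  constructor
  · intro h b hb
    rw [isBoundary_iff_const hb]
    exact h trivial
  · intro h v _
    obtain ⟨b, hb, rfl⟩ := exists_const_eq v
    exact (isBoundary_iff_const hb).mp (h b hb)

theorem betti_succ_eq_zero_iff (i j : ℕ) :
    F.betti (i + 1) j = 0 ↔ (F.koszulDoubleComplex j).RowVanish i 0 := by
  rw [betti_eq_zero_iff]
  constructor
  · intro h c hc b hb hcb
    rw [isBoundary_iff_const hb]
    refine h ?_
    rw [tensorCycles, LinearMap.mem_ker, ← const_row, const_eq_zero_iff (row_mem_part hb)]
    exact ⟨c, hc, hcb⟩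
  · intro h v hv
    obtain ⟨b, hb, rfl⟩ := exists_const_eq v
    rw [tensorCycles, LinearMap.mem_ker, ← const_row, const_eq_zero_iff (row_mem_part hb)] at hv
    obtain ⟨c, hc, hcb⟩ := hv
    exact (isBoundary_iff_const hb).mp (h c hc b hb hcb)

end

section

variable {Δ : LowerSet (Finset (Fin n))}
  {F : GradedFreeResolution (SComplex.stanleyReisnerIdeal k Δ)}

/-- The augmentation `F_0 → R/I`, lifted to `R`. -/
def augL {I : Ideal (MvPolynomial (Fin n) k)} (F : GradedFreeResolution I) :
    (Fin (F.rank 0) → MvPolynomial (Fin n) k) →ₗ[MvPolynomial (Fin n) k] MvPolynomial (Fin n) k :=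
  Fintype.linearCombination _ F.aug

theorem coeff_augL_comp {I : Ideal (MvPolynomial (Fin n) k)} (F : GradedFreeResolution I) (t : ℕ)
    (v : Fin (F.rank 0) → MvPolynomial (Fin n) k) (e : Fin n →₀ ℕ) :
    coeff e (F.augL (comp (F.deg 0) t v)) = if e.degree = t then coeff e (F.augL v) else 0 := by
  have hD : Homog (fun _ : Fin 1 => 0) (F.deg 0) (Matrix.of fun _ a => F.aug a) := by
    intro _ a e he
    rw [add_zero, Finsupp.degree_eq_weight_one]
    exact F.aug_homogeneous a (mem_support_iff.mp he)
  have h := congrArg (coeff e) (congrFun (mulVec_comp hD t v) 0)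
  have haug : ∀ w, (Matrix.of fun (_ : Fin 1) a => F.aug a).mulVecLin w 0 = F.augL w := by
    intro w
    change ∑ a, F.aug a * w a = ∑ a, w a * F.aug a
    exact Finset.sum_congr rfl fun a _ => mul_comm _ _
  rwa [coeff_comp, haug, haug, add_zero] at h

theorem isChainIn_augL {I : Ideal (MvPolynomial (Fin n) k)} {F : GradedFreeResolution I}
    {j q : ℕ} {c : Finset (Fin n) → Fin (F.rank 0) → MvPolynomial (Fin n) k}
    (hc : c ∈ F.part j 0 q) : IsChainIn {b | b.degree = j} q fun G => F.augL (c G) := by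
  intro G e he
  obtain ⟨a, x, y, rfl, hx, hy⟩ := exists_coeff_ne_zero_of_sum_mul he
  have h1 := mem_part.mp hc a G x hx
  have h2 : y.degree = F.deg 0 a := by
    rw [Finsupp.degree_eq_weight_one]
    exact F.aug_homogeneous a hy
  refine ⟨h1.1, ?_⟩
  rw [Set.mem_ofPred_eq, map_add, map_add, degree_expo]
  omega

/-- A Koszul chain with coefficients in `R/I_Δ` lifts along the augmentation to a chain with
coefficients in `F_0`, of the same internal degree. -/
theorem exists_augL_sub_mem {j q : ℕ} {f : Finset (Fin n) → MvPolynomial (Fin n) k}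
    (hf : IsChainIn {b | b.degree = j} q f) :
    ∃ c ∈ F.part j 0 q, ∀ G, f G - F.augL (c G) ∈ SComplex.stanleyReisnerIdeal k Δ := by
  choose v hv using fun G => F.aug_surjective (f G)
  have hdeg : ∀ G e, coeff e (f G) ≠ 0 → G.card = q ∧ e.degree + q = j := by
    intro G e he
    have := hf G e he
    rwa [Set.mem_ofPred_eq, map_add, degree_expo, and_congr_right fun h => by rw [h]] at this
  by_cases hqj : q ≤ j
  · refine ⟨_, comp_mem_part hqj v, fun G => ?_⟩
    split_ifs with hG
    · rw [mem_stanleyReisnerIdeal]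
      intro e he
      rw [coeff_sub, coeff_augL_comp]
      split_ifs with h
      · rw [← coeff_sub]
        exact mem_stanleyReisnerIdeal.mp (hv G) e he
      · rw [sub_zero]
        by_contra hne
        have := hdeg G e hne
        omega
    · have h0 : f G = 0 := by
        ext e
        by_contra hne
        exact hG (hdeg G e hne).1
      rw [map_zero, sub_zero, h0]
      exact zero_mem _
  · refine ⟨0, zero_mem _, fun G => ?_⟩
    have h0 : f G = 0 := by
      ext e
      by_contra hne
      have := hdeg G e hne
      omega
    rw [Pi.zero_apply, map_zero, sub_zero, h0]
    exact zero_mem _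

theorem augL_mem_iff {I : Ideal (MvPolynomial (Fin n) k)} {F : GradedFreeResolution I}
    {j q : ℕ} {c : Finset (Fin n) → Fin (F.rank 0) → MvPolynomial (Fin n) k}
    (hc : c ∈ F.part j 0 q) : (∀ G, F.augL (c G) ∈ I) ↔
      ∃ b ∈ F.part j 1 q, (fun G => (F.d 0).mulVecLin (b G)) = c := by
  constructor
  · intro h
    exact exists_row_eq hc fun G => (F.exact_zero (c G)).mp (h G)
  · rintro ⟨b, -, rfl⟩ G
    exact (F.exact_zero _).mpr ⟨b G, rfl⟩

/-- As `R/I_Δ` is the cokernel of `F_1 → F_0`, its Koszul homology can be computed with chains that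
have coefficients in `F_0`. -/
theorem acyclicIn_iff_isBoundary (j q : ℕ) :
    AcyclicIn k Δ {b | b.degree = j} q ↔ ∀ c ∈ F.part j 0 q,
      (∀ G, F.augL (Koszul.d (X (R := k)) c G) ∈ SComplex.stanleyReisnerIdeal k Δ) →
      (F.koszulDoubleComplex j).IsBoundary 0 q c := by
  constructor
  · intro h c hc hdc
    obtain ⟨g, hg, hcg⟩ := h _ (isChainIn_augL hc) fun G => by rw [d_map]; exact hdc G
    obtain ⟨w, hw, hgw⟩ := exists_augL_sub_mem (F := F) hg
    have hmem : c - Koszul.d (X (R := k)) w ∈ F.part j 0 q := sub_mem hc (col_mem_part hw)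
    obtain ⟨u, hu, huc⟩ := (augL_mem_iff hmem).mp fun G => by
      have h1 : Koszul.d (X (R := k)) (fun G => g G - F.augL (w G)) G ∈
          SComplex.stanleyReisnerIdeal k Δ := by
        rw [Koszul.d_apply]
        refine Ideal.sum_mem _ fun v _ => ?_
        exact Ideal.mul_mem_left _ _ (Ideal.mul_mem_left _ _ (hgw _))
      have h2 : Koszul.d (X (R := k)) (fun G => g G - F.augL (w G)) G =
          Koszul.d (X (R := k)) g G - F.augL (Koszul.d (X (R := k)) w G) := by
        rw [← congrFun (d_map _ F.augL w) G, ← Pi.sub_apply, ← map_sub]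
        rfl
      rw [h2] at h1
      rw [Pi.sub_apply, map_sub]
      convert add_mem (hcg G) h1 using 1
      ring
    exact ⟨u, hu, w, hw, sub_eq_iff_eq_add.mp huc.symm⟩
  · intro h f hf hdf
    obtain ⟨c, hc, hfc⟩ := exists_augL_sub_mem (F := F) hf
    have h1 : ∀ G, Koszul.d (X (R := k)) (fun G => f G - F.augL (c G)) G ∈
        SComplex.stanleyReisnerIdeal k Δ := by
      intro G
      rw [Koszul.d_apply]
      refine Ideal.sum_mem _ fun v _ => ?_
      exact Ideal.mul_mem_left _ _ (Ideal.mul_mem_left _ _ (hfc _))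
    have h2 : ∀ G, Koszul.d (X (R := k)) (fun G => f G - F.augL (c G)) G =
        Koszul.d (X (R := k)) f G - F.augL (Koszul.d (X (R := k)) c G) := by
      intro G
      rw [← congrFun (d_map _ F.augL c) G, ← Pi.sub_apply, ← map_sub]
      rfl
    obtain ⟨u, hu, w, hw, rfl⟩ := h c hc fun G => by
      convert sub_mem (hdf G) (h1 G) using 1
      rw [h2]
      ring
    refine ⟨fun G => F.augL (w G), isChainIn_augL hw, fun G => ?_⟩
    rw [d_map]
    have h3 := (augL_mem_iff (row_mem_part hu)).mpr ⟨u, hu, rfl⟩ G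
    convert add_mem (hfc G) h3 using 1
    change _ = f G - F.augL ((F.d 0).mulVecLin (u G) + Koszul.d (X (R := k)) w G) +
      F.augL ((F.d 0).mulVecLin (u G))
    rw [map_add]
    ring

/-- The graded Betti numbers of `R/I_Δ` vanish exactly when its Koszul homology does. -/
theorem betti_eq_zero_iff_acyclicIn (F : GradedFreeResolution (SComplex.stanleyReisnerIdeal k Δ))
    (i j : ℕ) : F.betti i j = 0 ↔ AcyclicIn k Δ {b | b.degree = j} i := by
  rw [acyclicIn_iff_isBoundary (F := F)]
  cases i with
  | zero =>
    rw [betti_zero_eq_zero_iff]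
    refine forall₂_congr fun c hc => ⟨fun h _ => h, fun h => h fun G => ?_⟩
    have h0 : IsChain 0 c := fun G hG => by_contra fun h' => hG (eq_zero_of_mem_part hc h')
    rw [h0.d_eq_zero, Pi.zero_apply, map_zero]
    exact zero_mem _
  | succ i =>
    rw [betti_succ_eq_zero_iff, ← ExactDoubleComplex.colVanish_zero_iff_rowVanish_zero]
    refine forall₂_congr fun c hc => ?_
    rw [augL_mem_iff (col_mem_part hc)]
    exact ⟨fun h ⟨b, hb, hcb⟩ => h b hb hcb.symm, fun h b hb hcb => h ⟨b, hb, hcb.symm⟩⟩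

end

end GradedFreeResolution

/-! ### Reduced homology and the squarefree strands -/

/-- Exactness in the middle of a sequence `k^r → k^q → k^p` of maps between coordinate subspaces of
`k^ι`, both given by the entries of the matrix `B`. -/
def MiddleExact {k : Type*} [Field k] {ι : Type*} [Fintype ι] (B : ι → ι → k)
    (p q r : ι → Prop) : Prop :=
  ∀ z : ι → k, (∀ S, z S ≠ 0 → q S) → (∀ G, p G → ∑ F, B G F * z F = 0) →
    ∃ w : ι → k, (∀ F, w F ≠ 0 → r F) ∧ ∀ S, q S → ∑ F, B S F * w F = z S

/-- A sequence of finite-dimensional vector spaces and its dual are exact in the middle at the same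
time. -/
theorem MiddleExact.transpose {k : Type*} [Field k] {ι : Type*} [Fintype ι] {B : ι → ι → k}
    {p q r : ι → Prop} (h : MiddleExact B p q r) : MiddleExact (fun F G => B G F) r q p := by
  classical
  intro θ hθ hr
  let L : (ι → k) →ₗ[k] (ι → k) × (ι → k) :=
    { toFun := fun z => (fun G => if p G then ∑ F, B G F * z F else 0,
        fun S => if q S then 0 else z S)
      map_add' := fun z w => by
        ext G
        · by_cases hG : p G <;> simp [hG, mul_add, Finset.sum_add_distrib]
        · by_cases hG : q G <;> simp [hG]
      map_smul' := fun c z => by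
        ext G
        · by_cases hG : p G <;> simp [hG, Finset.mul_sum, mul_left_comm]
        · by_cases hG : q G <;> simp [hG] }
  have hL1 : ∀ z G, (L z).1 G = if p G then ∑ F, B G F * z F else 0 := fun _ _ => rfl
  have hL2 : ∀ z S, (L z).2 S = if q S then 0 else z S := fun _ _ => rfl
  -- The functional `θ` vanishes on the kernel of `L`, so it factors through `L`.
  have hmem : Fintype.linearCombination k θ ∈ LinearMap.range L.dualMap := by
    rw [LinearMap.range_dualMap_eq_dualAnnihilator_ker, Submodule.mem_dualAnnihilator]
    intro z hz
    rw [LinearMap.mem_ker] at hz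
    obtain ⟨w, hw, hwz⟩ := h z (fun S hS => by
      by_contra hq
      have := hL2 z S
      rw [hz, if_neg hq] at this
      exact hS this.symm) (fun G hG => by
      have := hL1 z G
      rw [hz, if_pos hG] at this
      exact this.symm)
    have h1 : ∀ S, z S * θ S = ∑ F, w F * (B S F * θ S) := by
      intro S
      by_cases hS : θ S = 0
      · simp [hS]
      · rw [← hwz S (hθ S hS), Finset.sum_mul]
        exact Finset.sum_congr rfl fun F _ => by ring
    rw [Fintype.linearCombination_apply]
    simp only [smul_eq_mul, h1]
    rw [Finset.sum_comm]
    refine Finset.sum_eq_zero fun F _ => ?_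
    rw [← Finset.mul_sum]
    by_cases hF : w F = 0
    · rw [hF, zero_mul]
    · rw [hr F (hw F hF), mul_zero]
  obtain ⟨g, hg⟩ := hmem
  refine ⟨fun G => if p G then g (Pi.single G 1, 0) else 0, fun G hG => ?_, fun S hS => ?_⟩
  · by_contra h'
    exact hG (if_neg h')
  · have h1 := LinearMap.congr_fun hg (Pi.single S 1)
    rw [LinearMap.dualMap_apply, Fintype.linearCombination_apply_single, one_smul] at h1
    rw [← h1]
    have h2 : L (Pi.single S 1) =
        LinearMap.inl k (ι → k) (ι → k) fun G => if p G then B G S else 0 := by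
      ext G
      · rw [hL1]
        simp [Pi.single_apply]
      · rw [hL2]
        by_cases hG : q G
        · simp [hG]
        · have : G ≠ S := fun h' => hG (h' ▸ hS)
          simp [hG, this]
    rw [h2, ← LinearMap.comp_apply, LinearMap.pi_apply_eq_sum_univ]
    refine Finset.sum_congr rfl fun G _ => ?_
    have h3 : (fun j => if G = j then (1 : k) else 0) = Pi.single G 1 := by
      funext j
      simp [Pi.single_apply, eq_comm]
    rw [h3]
    by_cases hG : p G <;> simp [hG]

theorem middleExact_transpose_iff {k : Type*} [Field k] {ι : Type*} [Fintype ι] {B : ι → ι → k}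
    {p q r : ι → Prop} : MiddleExact (fun F G => B G F) r q p ↔ MiddleExact B p q r :=
  ⟨fun h => h.transpose, fun h => h.transpose⟩

namespace Koszul

variable {n : ℕ} {k : Type*} [Field k]

/-- The entries of the matrix of the simplicial boundary map. -/
def incidence (k : Type*) [Field k] (G F : Finset (Fin n)) : k :=
  ∑ v ∈ Finset.univ \ G, if insert v G = F then sign k G v else 0

theorem sum_incidence_mul (f : Finset (Fin n) → k) (G : Finset (Fin n)) :
    ∑ F, incidence k G F * f F = SComplex.boundary k f G := by
  simp only [incidence, Finset.sum_mul]
  rw [Finset.sum_comm]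
  refine Finset.sum_congr rfl fun v _ => ?_
  simp [ite_mul, sign]

/-- The transpose of the matrix of the boundary map is that of the coboundary map. -/
theorem sum_incidence_mul' (θ : Finset (Fin n) → k) (F : Finset (Fin n)) :
    ∑ S, incidence k S F * θ S = ∑ v ∈ F, sign k F v * θ (F.erase v) := by
  have h1 : ∀ S, incidence k S F * θ S =
      ∑ v, if v ∈ F ∧ F.erase v = S then sign k F v * θ (F.erase v) else 0 := by
    intro S
    rw [incidence, Finset.sum_mul, ← Finset.sum_subset (Finset.subset_univ (Finset.univ \ S))]
    · refine Finset.sum_congr rfl fun v hv => ?_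
      have hv : v ∉ S := by simpa using hv
      by_cases h : insert v S = F
      · subst h
        rw [if_pos rfl, if_pos ⟨by simp, Finset.erase_insert hv⟩, Finset.erase_insert hv,
          sign_insert_of_le le_rfl]
      · rw [if_neg h, zero_mul, if_neg]
        rintro ⟨h2, rfl⟩
        exact h (Finset.insert_erase h2)
    · intro v _ hv
      have hv : v ∈ S := by simpa using hv
      rw [if_neg]
      rintro ⟨-, rfl⟩
      simp at hv
  simp only [h1]
  rw [Finset.sum_comm, ← Finset.sum_subset (Finset.subset_univ F)]
  · refine Finset.sum_congr rfl fun v hv => ?_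
    simp [hv]
  · intro v _ hv
    simp [hv]

theorem induced_face {Δ : LowerSet (Finset (Fin n))} {V S : Finset (Fin n)} :
    S ∈ SComplex.induced Δ V ↔ S ∈ Δ ∧ S ⊆ V := Iff.rfl

/-- The vanishing of `H̃_{m-1}`, expressed by the incidence matrix. -/
theorem finrank_reducedHomology_eq_zero_iff (Δ : LowerSet (Finset (Fin n))) (m : ℕ) :
    Module.finrank k (SComplex.ReducedHomology k Δ ((m : ℤ) - 1)) = 0 ↔
      MiddleExact (incidence k) (fun S => S ∈ Δ ∧ S.card + 1 = m) (fun S => S ∈ Δ ∧ S.card = m)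
        (fun S => S ∈ Δ ∧ S.card = m + 1) := by
  have hmem : ∀ (i : ℕ) (q : ℤ) (f : Finset (Fin n) → k), q + 1 = i →
      (f ∈ SComplex.chains k Δ q ↔ ∀ S, f S ≠ 0 → S ∈ Δ ∧ S.card = i) := by
    intro i q f hq
    refine forall₂_congr fun S _ => and_congr_right fun _ => ?_
    rw [hq]
    exact_mod_cast Iff.rfl
  have hbd : ∀ (i : ℕ) (f : Finset (Fin n) → k), (∀ S, f S ≠ 0 → S ∈ Δ ∧ S.card = i) →
      ∀ G, SComplex.boundary k f G ≠ 0 → G ∈ Δ ∧ G.card + 1 = i := by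
    intro i f hf G hG
    obtain ⟨v, hv, hne⟩ := Finset.exists_ne_zero_of_sum_ne_zero hG
    obtain ⟨h1, h2⟩ := hf _ (right_ne_zero_of_mul hne)
    rw [Finset.card_insert_of_notMem (by simpa using hv)] at h2
    exact ⟨Δ.lower (Finset.subset_insert v G) h1, h2⟩
  rw [finrank_quotient_submoduleOf_eq_zero_iff]
  simp only [MiddleExact, sum_incidence_mul]
  constructor
  · intro h z hz hdz
    obtain ⟨w, hw, hwz⟩ := h (x := z) ⟨(hmem m _ z (by ring)).mpr hz, by
      rw [SetLike.mem_coe, LinearMap.mem_ker]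
      funext G
      by_contra hne
      exact hne (hdz G (hbd m z hz G hne))⟩
    exact ⟨w, (hmem (m + 1) _ w (by push_cast; ring)).mp hw, fun S _ => congrFun hwz S⟩
  · rintro h z ⟨hz, hdz⟩
    have hz' := (hmem m _ z (by ring)).mp hz
    obtain ⟨w, hw, hwz⟩ := h z hz' fun G _ => congrFun hdz G
    refine ⟨w, (hmem (m + 1) _ w (by push_cast; ring)).mpr hw, funext fun S => ?_⟩
    by_cases hS : S ∈ Δ ∧ S.card = m
    · exact hwz S hS
    · rw [show z S = 0 from by_contra fun h' => hS (hz' S h')]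
      by_contra hne
      have := hbd _ w hw S hne
      exact hS ⟨this.1, by omega⟩

/-- The sign relating the boundary map on subsets of `V` to the coboundary map on their
complements in `V`. -/
def complSign (k : Type*) [Field k] (V S : Finset (Fin n)) : k := ∏ v ∈ S, sign k V v

theorem complSign_mul_self (V S : Finset (Fin n)) :
    complSign k V S * complSign k V S = 1 := by
  rw [complSign, ← Finset.prod_mul_distrib]
  exact Finset.prod_eq_one fun v _ => sign_mul_self V v

theorem sign_sdiff {V S : Finset (Fin n)} (h : S ⊆ V) (v : Fin n) :
    sign k (V \ S) v = sign k V v * sign k S v := by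
  have h1 : sign k V v = sign k (V \ S) v * sign k S v := by
    rw [sign, sign, sign, ← pow_add, ← Finset.card_union_of_disjoint
      (Finset.disjoint_filter_filter Finset.sdiff_disjoint), ← Finset.filter_union,
      Finset.sdiff_union_of_subset h]
  rw [h1, mul_assoc, sign_mul_self, mul_one]

theorem boundary_sdiff {V S : Finset (Fin n)} (hS : S ⊆ V) {φ θ : Finset (Fin n) → k}
    (hφ : ∀ F, φ F ≠ 0 → F ⊆ V)
    (hθ : ∀ v ∈ S, θ (S.erase v) = complSign k V (S.erase v) * φ (V \ S.erase v)) :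
    SComplex.boundary k φ (V \ S) =
      complSign k V S * ∑ v ∈ S, sign k S v * θ (S.erase v) := by
  rw [boundary_eq_d, d_apply, Finset.mul_sum,
    ← Finset.sum_subset (s₁ := S) (fun v hv => by simp [hv])]
  · refine Finset.sum_congr rfl fun v hv => ?_
    have h1 : insert v (V \ S) = V \ S.erase v := (Finset.sdiff_erase (hS hv)).symm
    have h2 : complSign k V S = sign k V v * complSign k V (S.erase v) :=
      (Finset.mul_prod_erase S _ hv).symm
    rw [hθ v hv, h1, h2, sign_sdiff hS, one_smul, smul_eq_mul]
    have h3 := complSign_mul_self (k := k) V (S.erase v)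
    linear_combination (-(sign k V v * sign k S v * φ (V \ S.erase v))) * h3
  · intro v hv hvS
    rw [show φ (insert v (V \ S)) = 0 from ?_, smul_zero, smul_zero]
    by_contra hne
    have h1 : v ∈ V := hφ _ hne (Finset.mem_insert_self _ _)
    simp [h1, hvS] at hv

/-- The strand of squarefree multidegree `V` of the Koszul complex of `R/I_Δ` is, up to signs, the
augmented cochain complex of `Δ_V`, the set `F` corresponding to the face `V \ F`. -/
theorem strandAcyclic_expo_iff_middleExact (Δ : LowerSet (Finset (Fin n))) {V : Finset (Fin n)}
    {i m : ℕ} (hV : V.card = i + m) :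
    StrandAcyclic k Δ (expo V) i ↔ MiddleExact (fun F G => incidence k G F)
      (fun S => S ∈ SComplex.induced Δ V ∧ S.card = m + 1)
      (fun S => S ∈ SComplex.induced Δ V ∧ S.card = m)
      (fun S => S ∈ SComplex.induced Δ V ∧ S.card + 1 = m) := by
  classical
  have hcard : ∀ F, F ⊆ V → (V \ F).card + F.card = V.card := fun F hF =>
    Finset.card_sdiff_add_card_eq_card hF
  simp only [StrandAcyclic, MiddleExact, sum_incidence_mul', support_expo, support_expo_sub,
    induced_face]
  constructor
  · intro h θ hθ hdθ
    -- The chain that corresponds to `θ` is `F ↦ ± θ (V \ F)`.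
    have hφθ : ∀ S, S ⊆ V → θ S = complSign k V S *
        (if V \ S ⊆ V then complSign k V (V \ (V \ S)) * θ (V \ (V \ S)) else 0) := by
      intro S hS
      rw [if_pos Finset.sdiff_subset, Finset.sdiff_sdiff_eq_self hS, ← mul_assoc,
        complSign_mul_self, one_mul]
    obtain ⟨ψ, hψ, hψφ⟩ := h (fun F => if F ⊆ V then complSign k V (V \ F) * θ (V \ F) else 0)
      (fun F hF => by
        by_cases hFV : F ⊆ V
        · rw [if_pos hFV] at hF
          have h1 := (hθ _ (right_ne_zero_of_mul hF)).2
          have h2 := hcard F hFV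
          exact ⟨by omega, hFV⟩
        · exact absurd (if_neg hFV) hF)
      (fun G hG hGΔ => by
        have hS : V \ G ⊆ V := Finset.sdiff_subset
        rw [← Finset.sdiff_sdiff_eq_self hG, boundary_sdiff (θ := θ) hS (fun F hF => by
            by_contra h'
            exact hF (if_neg h')) fun v _ => hφθ _ ((Finset.erase_subset _ _).trans hS)]
        by_cases hm : (V \ G).card = m + 1
        · rw [hdθ _ ⟨⟨hGΔ, hS⟩, hm⟩, mul_zero]
        · rw [Finset.sum_eq_zero, mul_zero]
          intro v hv
          rw [show θ ((V \ G).erase v) = 0 from ?_, mul_zero]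
          by_contra hne
          have h1 := (hθ _ hne).2
          have h2 := Finset.card_erase_add_one hv
          omega)
    refine ⟨fun S => if S ∈ Δ ∧ S ⊆ V then complSign k V S * ψ (V \ S) else 0,
      fun S hS => ?_, fun S hS => ?_⟩
    · by_cases hSV : S ∈ Δ ∧ S ⊆ V
      · beta_reduce at hS
        rw [if_pos hSV] at hS
        have h1 := (hψ _ (right_ne_zero_of_mul hS)).1
        have h2 := hcard S hSV.2
        exact ⟨hSV, by omega⟩
      · exact absurd (if_neg hSV) hS
    · obtain ⟨⟨hSΔ, hSV⟩, hSm⟩ := hS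
      have h1 := boundary_sdiff (φ := ψ)
        (θ := fun S => if S ∈ Δ ∧ S ⊆ V then complSign k V S * ψ (V \ S) else 0) hSV
        (fun F hF => (hψ F hF).2) fun v _ => if_pos
          ⟨Δ.lower (Finset.erase_subset v S) hSΔ, (Finset.erase_subset v S).trans hSV⟩
      rw [← hψφ _ Finset.sdiff_subset (by rwa [Finset.sdiff_sdiff_eq_self hSV])] at h1
      rw [hφθ S hSV, h1, ← mul_assoc, complSign_mul_self, one_mul]
  · intro h φ hφ hdφ
    obtain ⟨η, hη, hηθ⟩ := h
      (fun S => if S ∈ Δ ∧ S ⊆ V then complSign k V S * φ (V \ S) else 0)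
      (fun S hS => by
        by_cases hSV : S ∈ Δ ∧ S ⊆ V
        · rw [if_pos hSV] at hS
          have h1 := (hφ _ (right_ne_zero_of_mul hS)).1
          have h2 := hcard S hSV.2
          exact ⟨hSV, by omega⟩
        · exact absurd (if_neg hSV) hS)
      (fun S hS => by
        obtain ⟨⟨hSΔ, hSV⟩, hSm⟩ := hS
        have h1 := boundary_sdiff (φ := φ)
          (θ := fun S => if S ∈ Δ ∧ S ⊆ V then complSign k V S * φ (V \ S) else 0) hSV
          (fun F hF => (hφ F hF).2) fun v _ => if_pos
            ⟨Δ.lower (Finset.erase_subset v S) hSΔ, (Finset.erase_subset v S).trans hSV⟩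
        rw [hdφ _ Finset.sdiff_subset (by rwa [Finset.sdiff_sdiff_eq_self hSV])] at h1
        have h2 := congrArg (complSign k V S * ·) h1
        simp only [mul_zero, ← mul_assoc, complSign_mul_self, one_mul] at h2
        exact h2.symm)
    have hψc : ∀ F, (if F ⊆ V then complSign k V (V \ F) * η (V \ F) else 0) ≠ 0 →
        F.card = i + 1 ∧ F ⊆ V := by
      intro F hF
      by_cases hFV : F ⊆ V
      · rw [if_pos hFV] at hF
        have h1 := (hη _ (right_ne_zero_of_mul hF)).2
        have h2 := hcard F hFV
        exact ⟨by omega, hFV⟩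
      · exact absurd (if_neg hFV) hF
    refine ⟨fun F => if F ⊆ V then complSign k V (V \ F) * η (V \ F) else 0, hψc,
      fun F hF hFΔ => ?_⟩
    by_cases hFi : F.card = i
    · have hS : V \ F ⊆ V := Finset.sdiff_subset
      have h1 := hηθ (V \ F) ⟨⟨hFΔ, hS⟩, by have := hcard F hF; omega⟩
      rw [if_pos ⟨hFΔ, hS⟩, Finset.sdiff_sdiff_eq_self hF] at h1
      have h2 := boundary_sdiff (θ := η)
        (φ := fun F => if F ⊆ V then complSign k V (V \ F) * η (V \ F) else 0) hS
        (fun F hF => (hψc F hF).2) fun v _ => by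
          rw [if_pos Finset.sdiff_subset, Finset.sdiff_sdiff_eq_self
            ((Finset.erase_subset _ _).trans hS), ← mul_assoc, complSign_mul_self, one_mul]
      rw [Finset.sdiff_sdiff_eq_self hF, h1, ← mul_assoc, complSign_mul_self, one_mul] at h2
      exact h2.symm
    · rw [show φ F = 0 from by_contra fun h' => hFi (hφ F h').1, boundary_eq_d]
      by_contra hne
      exact hFi (IsChain.d (R := k) (fun F hF => (hψc F hF).1) _ F (Ne.symm hne))

/-- Hochster's formula, as far as vanishing is concerned. -/
theorem strandAcyclic_expo_iff (Δ : LowerSet (Finset (Fin n))) {V : Finset (Fin n)}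
    {i m : ℕ} (hV : V.card = i + m) : StrandAcyclic k Δ (expo V) i ↔
      Module.finrank k (SComplex.ReducedHomology k (SComplex.induced Δ V) ((m : ℤ) - 1)) = 0 := by
  rw [strandAcyclic_expo_iff_middleExact Δ hV, middleExact_transpose_iff,
    finrank_reducedHomology_eq_zero_iff]

end Koszul

/-! ### Projective dimension, depth and the linear strand -/

namespace Koszul

variable {n : ℕ} {k : Type*} [Field k]

theorem mkQ_d (I : Ideal (MvPolynomial (Fin n) k)) (f : Finset (Fin n) → MvPolynomial (Fin n) k) :
    d (X (R := k)) (fun F => Submodule.mkQ I (f F)) = 0 ↔ ∀ F, d (X (R := k)) f F ∈ I := by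
  rw [d_map, funext_iff]
  refine forall_congr' fun F => ?_
  exact Submodule.Quotient.mk_eq_zero I

/-- The Koszul homology of `R/I_Δ` is the sum of the homologies of its multigraded strands. -/
theorem acyclic_quotient_iff (Δ : LowerSet (Finset (Fin n))) (i : ℕ) :
    Acyclic (X (σ := Fin n) (R := k))
      (MvPolynomial (Fin n) k ⧸ SComplex.stanleyReisnerIdeal k Δ) i ↔
      ∀ a, StrandAcyclic k Δ a i := by
  have huniv : (∀ a, StrandAcyclic k Δ a i) ↔ AcyclicIn k Δ Set.univ i := by
    simp [acyclicIn_iff]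
  have hchain : ∀ (i : ℕ) (f : Finset (Fin n) → MvPolynomial (Fin n) k),
      IsChain i f → IsChainIn Set.univ i f :=
    fun i f hf F e he => ⟨hf F fun h => he (by rw [h, coeff_zero]), trivial⟩
  have hsurj := Submodule.mkQ_surjective (SComplex.stanleyReisnerIdeal k Δ)
  rw [huniv]
  constructor
  · intro h f hf hdf
    obtain ⟨g, hg, hgf⟩ := h _ (hf.isChain.map (Submodule.mkQ _)) ((mkQ_d _ f).mpr hdf)
    obtain ⟨g, hg', rfl⟩ := hg.exists_lift hsurj
    refine ⟨g, hchain _ _ hg', fun F => ?_⟩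
    rw [d_map] at hgf
    exact (Submodule.Quotient.eq _).mp (congrFun hgf F).symm
  · intro h f hf hdf
    obtain ⟨f, hf', rfl⟩ := hf.exists_lift hsurj
    obtain ⟨g, hg, hgf⟩ := h f (hchain _ _ hf') ((mkQ_d _ f).mp hdf)
    refine ⟨_, hg.isChain.map (Submodule.mkQ _), ?_⟩
    rw [d_map]
    exact funext fun F => ((Submodule.Quotient.eq _).mpr (hgf F)).symm

/-- For `∅ ∈ Δ` the ring `R/I_Δ` is not zero, and neither is `R/I_Δ ⊗ k`. -/
theorem not_strandAcyclic_zero_zero {Δ : LowerSet (Finset (Fin n))} (h : ∅ ∈ Δ) :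
    ¬ StrandAcyclic k Δ 0 0 := by
  intro hs
  obtain ⟨ψ, hψ, hφψ⟩ := hs (Pi.single ∅ 1) (fun F hF => by
      obtain rfl : F = ∅ := by
        by_contra h'
        exact hF (by simp [h'])
      simp) (fun G _ _ => by
      rw [boundary_eq_d, IsChain.d_eq_zero, Pi.zero_apply]
      intro F hF
      by_contra h'
      exact hF (Pi.single_eq_of_ne (by rintro rfl; exact h' rfl) _))
  have h1 := hφψ ∅ (Finset.empty_subset _) (by simpa using h)
  rw [show ψ = 0 from funext fun F => by_contra fun h' => ?_, map_zero] at h1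
  · simp at h1
  · obtain ⟨h2, h3⟩ := hψ F h'
    rw [Finsupp.support_zero, Finset.subset_empty] at h3
    simp [h3] at h2

/-- A minimal nonface contributes a minimal generator of the Stanley--Reisner ideal, so a first
syzygy of `R/I_Δ` in its multidegree. -/
theorem not_strandAcyclic_of_minimal_nonface {Δ : LowerSet (Finset (Fin n))}
    {G : Finset (Fin n)} (hG : G ∉ Δ) (hproper : ∀ v ∈ G, G.erase v ∈ Δ) (hne : G.Nonempty) :
    ¬ StrandAcyclic k Δ (expo G) 1 := by
  intro hs
  obtain ⟨v, hv⟩ := hne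
  have hφ : ∀ F : Finset (Fin n), (Pi.single {v} 1 : Finset (Fin n) → k) F ≠ 0 → F = {v} := by
    intro F hF
    by_contra h'
    exact hF (Pi.single_eq_of_ne h' _)
  simp only [StrandAcyclic, support_expo, support_expo_sub] at hs
  obtain ⟨ψ, hψ, hφψ⟩ := hs (Pi.single {v} 1) (fun F hF => by
      rw [hφ F hF]
      simpa using hv) (fun F hF hFΔ => by
      by_contra hne
      rw [boundary_eq_d] at hne
      have hc : IsChain 1 (Pi.single {v} 1 : Finset (Fin n) → k) :=
        fun F hF => by rw [hφ F hF]; simp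
      have h1 := hc.d _ F hne
      rw [Finset.card_eq_zero.mp h1, Finset.sdiff_empty] at hFΔ
      exact hG hFΔ)
  -- The vertices of `G` cannot be boundaries of edges, because the augmentation of `v` is `1`.
  have h1 : SComplex.boundary k (Pi.single {v} 1) ∅ =
      SComplex.boundary k (SComplex.boundary k ψ) (∅ : Finset (Fin n)) := by
    have hsum : ∀ f : Finset (Fin n) → k, SComplex.boundary k f ∅ =
        ∑ u ∈ Finset.univ \ ∅, sign k ∅ u * f (insert u ∅) := fun _ => rfl
    rw [hsum, hsum]
    refine Finset.sum_congr rfl fun u _ => ?_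
    congr 1
    by_cases hu : u ∈ G
    · refine hφψ _ (by simpa using hu) ?_
      rw [insert_empty_eq, Finset.sdiff_singleton_eq_erase]
      exact hproper u hu
    · rw [Pi.single_eq_of_ne (by
        rw [insert_empty_eq, Ne, Finset.singleton_inj]
        rintro rfl
        exact hu hv), eq_comm]
      by_contra hne
      rw [boundary_eq_d, d_apply] at hne
      obtain ⟨w, -, hw⟩ := Finset.exists_ne_zero_of_sum_ne_zero hne
      exact hu ((hψ _ fun h0 => hw (by rw [h0, smul_zero, smul_zero])).2 (by simp))
  rw [boundary_eq_d, d_d, d_apply, Finset.sum_eq_single v] at h1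
  · simp [sign] at h1
  · intro u _ hu
    rw [Pi.single_eq_of_ne (by simpa using hu), smul_zero, smul_zero]
  · simp

end Koszul

open Koszul

namespace GradedFreeResolution

variable {n : ℕ} {k : Type*} [Field k] {Δ : LowerSet (Finset (Fin n))}

theorem betti_ne_zero_iff (F : GradedFreeResolution (SComplex.stanleyReisnerIdeal k Δ))
    (i j : ℕ) : F.betti i j ≠ 0 ↔ ∃ a, a.degree = j ∧ ¬ StrandAcyclic k Δ a i := by
  rw [Ne, betti_eq_zero_iff_acyclicIn, acyclicIn_iff]
  simp

/-- The projective dimension is the top nonvanishing degree of the Koszul homology of `R/I_Δ`. -/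
theorem exists_betti_ne_zero_iff (F : GradedFreeResolution (SComplex.stanleyReisnerIdeal k Δ))
    (i : ℕ) : (∃ j, F.betti i j ≠ 0) ↔ ¬ Acyclic (X (σ := Fin n) (R := k))
      (MvPolynomial (Fin n) k ⧸ SComplex.stanleyReisnerIdeal k Δ) i := by
  simp [betti_ne_zero_iff, acyclic_quotient_iff]

/-- The Auslander--Buchsbaum formula for a Stanley--Reisner ring that is not zero. -/
theorem exists_pd_and_polyDepth (F : GradedFreeResolution (SComplex.stanleyReisnerIdeal k Δ))
    (h : ∅ ∈ Δ) : ∃ p ≤ n, IsGreatest {i : ℕ | ∃ j : ℕ, F.betti i j ≠ 0} p ∧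
      polyDepth (k := k) (n := n)
        (MvPolynomial (Fin n) k ⧸ SComplex.stanleyReisnerIdeal k Δ) = (n - p : ℕ) := by
  simp only [exists_betti_ne_zero_iff]
  obtain ⟨p, hp⟩ := BddAbove.exists_isGreatest_of_nonempty
    (S := {i | ¬ Acyclic (X (σ := Fin n) (R := k))
      (MvPolynomial (Fin n) k ⧸ SComplex.stanleyReisnerIdeal k Δ) i})
    ⟨n, fun i hi => by
      by_contra hlt
      exact hi (acyclic_of_lt (by omega))⟩
    ⟨0, fun h0 => not_strandAcyclic_zero_zero h ((acyclic_quotient_iff Δ 0).mp h0 0)⟩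
  obtain ⟨h1, h2⟩ := polyDepth_eq _ hp
  exact ⟨p, h1, hp, h2⟩

/-- Hochster's formula for the Betti numbers of a strand, as far as vanishing is concerned. -/
theorem betti_add_ne_zero_iff (F : GradedFreeResolution (SComplex.stanleyReisnerIdeal k Δ))
    (i m : ℕ) : F.betti i (i + m) ≠ 0 ↔ ∃ V : Finset (Fin n), V.card = i + m ∧
      Module.finrank k (SComplex.ReducedHomology k (SComplex.induced Δ V) ((m : ℤ) - 1)) ≠ 0 := by
  rw [betti_ne_zero_iff]
  constructor
  · rintro ⟨a, ha, hs⟩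
    have hle : ∀ v, a v ≤ 1 := fun v => by
      by_contra h
      exact hs (strandAcyclic_of_two_le Δ (v := v) (by omega) i)
    have hexp : a = expo a.support := by
      ext v
      have := hle v
      rw [expo_apply]
      split_ifs with h <;> simp at h <;> omega
    have hcard : a.support.card = i + m := by rw [← degree_expo, ← hexp, ha]
    refine ⟨a.support, hcard, ?_⟩
    rwa [Ne, ← strandAcyclic_expo_iff Δ hcard, ← hexp]
  · rintro ⟨V, hV, hne⟩
    exact ⟨expo V, by rw [degree_expo, hV], fun hs => hne ((strandAcyclic_expo_iff Δ hV).mp hs)⟩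

end GradedFreeResolution

theorem le_card_of_finrank_reducedHomology_ne_zero {n : ℕ} {k : Type*} [Field k]
    {Δ : LowerSet (Finset (Fin n))} {V : Finset (Fin n)} {m : ℕ}
    (h : Module.finrank k
      (SComplex.ReducedHomology k (SComplex.induced Δ V) ((m : ℤ) - 1)) ≠ 0) : m ≤ V.card := by
  by_contra hlt
  refine h ((finrank_reducedHomology_eq_zero_iff _ m).mpr fun z hz _ =>
    ⟨0, fun F hF => absurd rfl hF, ?_⟩)
  rintro S ⟨hS, rfl⟩
  exact absurd (Finset.card_le_card hS.2) hlt

namespace Hypergraph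

variable {n d : ℕ} {H : Hypergraph (Fin n)}

theorem empty_mem_cliqueComplex (hd : d ≠ 0) : ∅ ∈ H.cliqueComplex d := by
  intro G hG hGd
  rw [Finset.subset_empty.mp hG] at hGd
  exact absurd hGd.symm hd

theorem cliqueComplex_eq_top (h : H.ContainsAll d) : H.cliqueComplex d = ⊤ := by
  ext S
  exact ⟨fun _ => trivial, fun _ G _ hG => h G hG⟩

/-- A `d`-element set that is not an edge is a minimal nonface of the clique complex. -/
theorem exists_minimal_nonface (h : ¬ H.ContainsAll d) :
    ∃ G : Finset (Fin n), G.card = d ∧ G ∉ H.cliqueComplex d ∧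
      ∀ v ∈ G, G.erase v ∈ H.cliqueComplex d := by
  simp only [ContainsAll, not_forall] at h
  obtain ⟨G, hG, hGH⟩ := h
  refine ⟨G, hG, fun h' => hGH (h' G subset_rfl hG), fun v hv G' hG' hG'd => ?_⟩
  have h1 := Finset.card_le_card hG'
  have h2 := Finset.card_erase_add_one hv
  omega

end Hypergraph

end

theorem mainTheorem9 (k : Type*) [Field k] (n d : ℕ) (hd : 2 ≤ d)
    (H : Hypergraph (Fin n)) (hH : H.IsUniformOn d)
    (F : GradedFreeResolution (SComplex.stanleyReisnerIdeal k (H.cliqueComplex d))) :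
    -- `g` is the depth and `p` the projective dimension of the Stanley-Reisner ring
    ∃ g p : ℕ,
      polyDepth (k := k) (n := n)
        (MvPolynomial (Fin n) k ⧸ SComplex.stanleyReisnerIdeal k (H.cliqueComplex d)) = g ∧
      IsGreatest {i : ℕ | ∃ j : ℕ, F.betti i j ≠ 0} p ∧
      -- if all `d`-sets are edges, there is no disconnecting set and the linear strand is zero
      (H.ContainsAll d → H.connectivity k d = ⊤ ∧ ∀ i : ℕ, F.betti i (i + d - 1) = 0) ∧
      -- otherwise, with `c` the connectivity and `l` the length of the linear strand:
      (¬ H.ContainsAll d → ∃ (c l : ℕ) (r : ℤ),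
        H.connectivity k d = c ∧
        IsGreatest {i : ℕ | F.betti i (i + d - 1) ≠ 0} l ∧
        IsLeast {r : ℤ | ∃ i j : ℕ, (i : ℤ) = n - g - r ∧ (j : ℤ) = n - g - r + d - 1 ∧
          F.betti i j ≠ 0} r ∧
        IsLeast {r : ℤ | ∃ V : Finset (Fin n), (V.card : ℤ) = n - (g - d + r + 1) ∧
          Module.finrank k (SComplex.ReducedHomology k
            (SComplex.induced (H.cliqueComplex d) V) ((d : ℤ) - 2)) ≠ 0} r ∧
        0 ≤ r ∧
        r = (p : ℤ) - l ∧
        (c : ℤ) = g - d + r + 1 ∧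
        (l = p → (g : ℤ) = c + d - 1)) := by
  obtain ⟨p, hpn, hp, hg⟩ := F.exists_pd_and_polyDepth
    (Hypergraph.empty_mem_cliqueComplex (by omega))
  refine ⟨n - p, p, hg, hp, ?_⟩
  obtain ⟨m, rfl⟩ : ∃ m, d = m + 1 := ⟨d - 1, by omega⟩
  -- With `d = m + 1`, the homology in question is `H̃_{m-1}`.
  have hm : ∀ i, i + (m + 1) - 1 = i + m := fun i => rfl
  simp only [Hypergraph.connectivity, hm]
  generalize hq : ((m + 1 : ℕ) : ℤ) - 2 = q
  obtain rfl : q = (m : ℤ) - 1 := by omega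
  have hB := F.betti_add_ne_zero_iff
  set Hne : Finset (Fin n) → Prop := fun V => Module.finrank k (SComplex.ReducedHomology k
    (SComplex.induced (H.cliqueComplex (m + 1)) V) ((m : ℤ) - 1)) ≠ 0
  have hle : ∀ V, Hne V → m ≤ V.card := fun V => le_card_of_finrank_reducedHomology_ne_zero
  have hBV : ∀ V, Hne V → ∃ i, V.card = i + m ∧ F.betti i (i + m) ≠ 0 := fun V hV => by
    have hVm : V.card = (V.card - m) + m := (Nat.sub_add_cancel (hle V hV)).symm
    exact ⟨V.card - m, hVm, (hB _ m).mpr ⟨V, hVm, hV⟩⟩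
  constructor
  · intro hall
    have hzero : ∀ i, F.betti i (i + m) = 0 := by
      intro i
      by_contra hne
      obtain ⟨a, ha, hs⟩ := (F.betti_ne_zero_iff i (i + m)).mp hne
      rw [Hypergraph.cliqueComplex_eq_top hall] at hs
      refine hs (Koszul.strandAcyclic_top ?_ i)
      rintro rfl
      rw [map_zero] at ha
      omega
    refine ⟨?_, hzero⟩
    rw [iInf₂_eq_top]
    intro V hV
    obtain ⟨i, -, hi⟩ := hBV _ hV
    exact absurd (hzero i) hi
  · intro hall
    have hne : {i : ℕ | F.betti i (i + m) ≠ 0}.Nonempty := by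
      obtain ⟨G, hGd, hG, hGe⟩ := Hypergraph.exists_minimal_nonface hall
      refine ⟨1, (F.betti_ne_zero_iff 1 (1 + m)).mpr ⟨Koszul.expo G, ?_,
        Koszul.not_strandAcyclic_of_minimal_nonface hG hGe ?_⟩⟩
      · rw [Koszul.degree_expo, hGd, add_comm]
      · rw [← Finset.card_pos]
        omega
    -- The largest `V` with nonvanishing homology have `l + m` vertices, so their complements are
    -- the smallest disconnecting sets.
    obtain ⟨l, hl⟩ := BddAbove.exists_isGreatest_of_nonempty
      (S := {i : ℕ | F.betti i (i + m) ≠ 0}) ⟨p, fun i hi => hp.2 ⟨_, hi⟩⟩ hne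
    have hlp : l ≤ p := hp.2 ⟨_, hl.1⟩
    obtain ⟨W, hWl, hW⟩ := (hB l m).mp hl.1
    have hWn : W.card ≤ n := by simpa using W.card_le_univ
    have hmax : ∀ V, Hne V → V.card ≤ l + m := by
      intro V hV
      obtain ⟨i, hi, hbi⟩ := hBV V hV
      have := hl.2 hbi
      omega
    refine ⟨n - (l + m), l, (p : ℤ) - l, ?_, hl, ⟨⟨l, l + m, by omega, by omega, hl.1⟩, ?_⟩,
      ⟨⟨W, by omega, hW⟩, ?_⟩, by omega, rfl, by omega, by omega⟩
    · refine le_antisymm ?_ (le_iInf₂ fun V hV => ?_)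
      · refine iInf₂_le_of_le Wᶜ ?_ ?_
        · change Hne (Finset.univ \ Wᶜ)
          rwa [← Finset.compl_eq_univ_sdiff, compl_compl]
        · rw [Finset.card_compl, Fintype.card_fin, hWl]
      · have h1 := hmax _ hV
        rw [← Finset.compl_eq_univ_sdiff, Finset.card_compl, Fintype.card_fin] at h1
        exact_mod_cast (by omega : n - (l + m) ≤ V.card)
    · rintro r ⟨i, j, hi, hj, hbij⟩
      obtain rfl : j = i + m := by omega
      have := hl.2 hbij
      omega
    · rintro r ⟨V, hVr, hV⟩
      have := hmax V hV
      omega
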